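/- Let $K$ be an algebraically closed field, let $r \ge 2$, let $R = K[x_0,\dots,x_r]$ and $\mathbb{P}^r = \operatorname{Proj}(R)$. For a closed subscheme $X \subseteq \mathbb{P}^r$ let $\mathcal{I}_X$ be its ideal sheaf and $I_X = \bigoplus_{n} H^0(\mathbb{P}^r, \mathcal{I}_X(n)) \subseteq R$ its saturated homogeneous ideal; $X$ is called arithmetically Cohen--Macaulay (ACM) if $R/I_X$ is a Cohen--Macaulay ring. Let $Y \subset \mathbb{P}^r$ be an ACM closed subscheme of codimension $2$ and let $\mathcal{N} = \mathcal{I}_Y \oplus \mathcal{I}_Y$. Let $D \subset \mathbb{P}^r$ be an ACM closed subscheme of codimension $2$ that is obtained from $\mathcal{N}$ in the following sense: there are a dissocié sheaf $\mathcal{P} = \bigoplus_{i=1}^n \mathcal{O}_{\mathbb{P}^r}(a_i)$ (equivalently, a torsion-free coherent sheaf of projective dimension $0$), an integer $k$, and a short exact sequence $$0 \to \mathcal{P} \to \mathcal{N} \to \mathcal{I}_D(k) \to 0 .$$ Then: 1. $I_D \subseteq I_Y^2$, and $\mathcal{I}_D \subseteq \mathcal{I}_Y^2$, that is, $D$ contains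 the first infinitesimal neighbourhood of $Y$ (the closed subscheme of $\mathbb{P}^r$ with ideal sheaf $\mathcal{I}_Y^2$). 2. $D$ is not a local complete intersection at any point $y$ of $Y$, that is, the stalk $\mathcal{I}_{D,y} \subseteq \mathcal{O}_{\mathbb{P}^r,y}$ is not generated by a regular sequence. 3. In particular, $D$ is not generically a local complete intersection: there is an irreducible component of $D$ at whose generic point $D$ is not a local complete intersection. -/

import Mathlib

open CategoryTheory CategoryTheory.Limits AlgebraicGeometry TopologicalSpace Opposite

attribute [local instance] MvPolynomial.gradedAlgebra

attribute [local instance] CategoryTheory.Abelian.hasFiniteBiproducts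

universe u

namespace ACMConstruction

noncomputable section

/-! ### The sheaf on `Proj A` associated to the graded module `I(k)` -/

section Twist

variable {A σ : Type u} [CommRing A] [SetLike σ A] [AddSubgroupClass σ A]
variable (𝒜 : ℕ → σ) [GradedRing 𝒜]

instance isPrime_top (x : ProjectiveSpectrum.top 𝒜) :
    (HomogeneousIdeal.toIdeal (ProjectiveSpectrum.asHomogeneousIdeal x)).IsPrime :=
  ProjectiveSpectrum.isPrime x

/-- The localization of `A` at the homogeneous prime `x` (elements of all degrees). -/
abbrev LocAt (x : ProjectiveSpectrum.top 𝒜) : Type u :=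
  Localization (ProjectiveSpectrum.asHomogeneousIdeal x).toIdeal.primeCompl

variable (I : Ideal A) (k : ℤ)

variable {𝒜} in
/-- `s` is given on all of `U` by one fraction `f / g`, where `f ∈ I` and `g` are homogeneous
and `deg f = deg g + k`. -/
def IsTwistFraction {U : Opens (ProjectiveSpectrum.top 𝒜)} (s : ∀ x : U, LocAt 𝒜 x.1) : Prop :=
  ∃ (i j : ℕ) (f g : A), f ∈ 𝒜 i ∧ f ∈ I ∧ g ∈ 𝒜 j ∧ (i : ℤ) = j + k ∧
    ∀ x : U, ∃ hg : g ∈ (ProjectiveSpectrum.asHomogeneousIdeal x.1).toIdeal.primeCompl,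
      s x = Localization.mk f ⟨g, hg⟩

/-- The property of being given by one fraction, as a prelocal predicate. -/
def isTwistFractionPrelocal : TopCat.PrelocalPredicate (LocAt 𝒜) where
  pred s := IsTwistFraction I k s
  res := by
    rintro V U i s ⟨a, b, f, g, hf, hfI, hg, h, w⟩
    exact ⟨a, b, f, g, hf, hfI, hg, h, fun x => w (i x)⟩

/-- Families of elements of the localizations that are locally fractions as above. -/
def isLocallyTwistFraction : TopCat.LocalPredicate (LocAt 𝒜) :=
  (isTwistFractionPrelocal 𝒜 I k).sheafify

theorem twist_zero_mem (U : Opens (ProjectiveSpectrum.top 𝒜)) :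
    (isLocallyTwistFraction 𝒜 I k).pred (0 : ∀ x : U, LocAt 𝒜 x.1) := by
  rintro ⟨x, hxU⟩
  obtain ⟨f, m, hf, hm, hx⟩ : ∃ (f : A) (m : ℕ) (_ : f ∈ 𝒜 m) (_ : 0 < m),
      f ∉ x.asHomogeneousIdeal := by
    classical
    by_contra! hcon
    refine x.not_irrelevant_le fun z hz => ?_
    rw [← DirectSum.sum_support_decompose 𝒜 z]
    exact x.1.toIdeal.sum_mem fun l hl =>
      hcon _ l (SetLike.coe_mem _) <| Nat.pos_of_ne_zero <| by aesop
  refine ⟨U ⊓ ProjectiveSpectrum.basicOpen 𝒜 f, ⟨hxU, hx⟩, Opens.infLELeft _ _,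
    ((k.natAbs * m : ℕ) + k).toNat, k.natAbs * m, 0, f ^ k.natAbs, zero_mem _, zero_mem _,
    ?_, ?_, ?_⟩
  · simpa [smul_eq_mul] using SetLike.pow_mem_graded k.natAbs hf
  · rw [Int.toNat_of_nonneg]
    have h1 : k.natAbs ≤ k.natAbs * m := Nat.le_mul_of_pos_right _ hm
    omega
  · rintro ⟨y, hyU, hyf⟩
    refine ⟨pow_mem (S := (ProjectiveSpectrum.asHomogeneousIdeal y).toIdeal.primeCompl) hyf _, ?_⟩
    exact (Localization.mk_zero _).symm

theorem twist_add_mem (U : Opens (ProjectiveSpectrum.top 𝒜)) (a b : ∀ x : U, LocAt 𝒜 x.1)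
    (ha : (isLocallyTwistFraction 𝒜 I k).pred a) (hb : (isLocallyTwistFraction 𝒜 I k).pred b) :
    (isLocallyTwistFraction 𝒜 I k).pred (a + b) := fun x => by
  obtain ⟨Va, ma, ia, i, j, f, g, hf, hfI, hg, h, wa⟩ := ha x
  obtain ⟨Vb, mb, ib, i', j', f', g', hf', hfI', hg', h', wb⟩ := hb x
  refine ⟨Va ⊓ Vb, ⟨ma, mb⟩, Opens.infLELeft _ _ ≫ ia, i + j', j + j', f * g' + f' * g, g * g',
    add_mem (SetLike.mul_mem_graded hf hg') ?_,
    add_mem (I.mul_mem_right _ hfI) (I.mul_mem_right _ hfI'),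
    SetLike.mul_mem_graded hg hg', by push_cast; omega, ?_⟩
  · have : i + j' = i' + j := by omega
    rw [this]
    exact SetLike.mul_mem_graded hf' hg
  · rintro ⟨y, hya, hyb⟩
    obtain ⟨h1, e1⟩ := wa ⟨y, hya⟩
    obtain ⟨h2, e2⟩ := wb ⟨y, hyb⟩
    refine ⟨mul_mem h1 h2, ?_⟩
    refine (congr($e1 + $e2)).trans ?_
    rw [Localization.add_mk]
    congr 1
    simp only
    ring

theorem twist_neg_mem (U : Opens (ProjectiveSpectrum.top 𝒜)) (a : ∀ x : U, LocAt 𝒜 x.1)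
    (ha : (isLocallyTwistFraction 𝒜 I k).pred a) :
    (isLocallyTwistFraction 𝒜 I k).pred (-a) := fun x => by
  obtain ⟨V, m, v, i, j, f, g, hf, hfI, hg, h, w⟩ := ha x
  refine ⟨V, m, v, i, j, -f, g, neg_mem hf, neg_mem hfI, hg, h, fun y => ?_⟩
  obtain ⟨h1, e1⟩ := w y
  refine ⟨h1, ?_⟩
  rw [← Localization.neg_mk]
  exact congr(-$e1)

/-- The sections over `U` of the sheaf associated to `I(k)`. -/
def twistSections (U : Opens (ProjectiveSpectrum.top 𝒜)) :
    AddSubgroup (∀ x : U, LocAt 𝒜 x.1) where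
  carrier := {s | (isLocallyTwistFraction 𝒜 I k).pred s}
  zero_mem' := twist_zero_mem 𝒜 I k U
  add_mem' := twist_add_mem 𝒜 I k U _ _
  neg_mem' := twist_neg_mem 𝒜 I k U _

open ProjectiveSpectrum.StructureSheaf in
theorem twist_smul_mem (U : (Opens (ProjectiveSpectrum.top 𝒜))ᵒᵖ) (t : sectionsSubring (𝒜 := 𝒜) U)
    (s : ∀ x : U.unop, LocAt 𝒜 x.1)
    (hs : (isLocallyTwistFraction 𝒜 I k).pred s) :
    (isLocallyTwistFraction 𝒜 I k).pred (fun x => HomogeneousLocalization.val (t.1 x) * s x) := fun x => by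
  obtain ⟨V, m, v, i, j, f, g, hf, hfI, hg, h, w⟩ := hs x
  obtain ⟨W, m', v', n, ⟨p, hp⟩, ⟨q, hq⟩, hqW, w'⟩ := t.2 x
  refine ⟨V ⊓ W, ⟨m, m'⟩, Opens.infLELeft _ _ ≫ v, n + i, n + j, p * f, q * g,
    SetLike.mul_mem_graded hp hf, I.mul_mem_left _ hfI, SetLike.mul_mem_graded hq hg,
    by push_cast; omega, ?_⟩
  rintro ⟨y, hyV, hyW⟩
  obtain ⟨h1, e1⟩ := w ⟨y, hyV⟩
  have e2 := w' ⟨y, hyW⟩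
  refine ⟨mul_mem (hqW ⟨y, hyW⟩) h1, ?_⟩
  refine (congrArg₂ (· * ·) (congrArg HomogeneousLocalization.val e2) e1).trans ?_
  rw [HomogeneousLocalization.val_mk, Localization.mk_mul]
  rfl

/-- The sheaf of sections, as a sheaf of types. -/
def twistInType : TopCat.Sheaf (Type u) (ProjectiveSpectrum.top 𝒜) :=
  TopCat.subsheafToTypes (isLocallyTwistFraction 𝒜 I k)

instance (U : (Opens (ProjectiveSpectrum.top 𝒜))ᵒᵖ) :
    AddCommGroup ((twistInType 𝒜 I k).obj.obj U) :=
  (twistSections 𝒜 I k U.unop).toAddCommGroup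

open ProjectiveSpectrum.StructureSheaf in
instance (U : (Opens (ProjectiveSpectrum.top 𝒜))ᵒᵖ) :
    Module ((structurePresheafInCommRing 𝒜).obj U) ((twistInType 𝒜 I k).obj.obj U) where
  smul t s := ⟨fun x => HomogeneousLocalization.val (t.1 x) * s.1 x, twist_smul_mem 𝒜 I k U t s.1 s.2⟩
  one_smul s := Subtype.ext <| funext fun x =>
    (congr($(HomogeneousLocalization.val_one) * s.1 x)).trans (one_mul _)
  mul_smul t t' s := Subtype.ext <| funext fun x =>
    (congr($(HomogeneousLocalization.val_mul (t.1 x) (t'.1 x)) * s.1 x)).trans (mul_assoc _ _ _)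
  smul_zero _ := Subtype.ext <| funext fun _ => mul_zero _
  smul_add _ _ _ := Subtype.ext <| funext fun _ => mul_add _ _ _
  add_smul t t' s := Subtype.ext <| funext fun x =>
    (congr($(HomogeneousLocalization.val_add (t.1 x) (t'.1 x)) * s.1 x)).trans (add_mul _ _ _)
  zero_smul s := Subtype.ext <| funext fun x =>
    (congr($(HomogeneousLocalization.val_zero) * s.1 x)).trans (zero_mul _)

/-- The presheaf of abelian groups underlying the sheaf associated to `I(k)`. -/
def twistInAb : TopCat.Presheaf AddCommGrpCat.{u} (ProjectiveSpectrum.top 𝒜) where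
  obj U := AddCommGrpCat.of ((twistInType 𝒜 I k).obj.obj U)
  map i := AddCommGrpCat.ofHom
    { toFun := (twistInType 𝒜 I k).obj.map i
      map_zero' := rfl
      map_add' := fun _ _ => rfl }

open ProjectiveSpectrum.StructureSheaf in
/-- The presheaf of modules underlying the sheaf associated to `I(k)`. -/
def twistPresheaf :
    PresheafOfModules (structurePresheafInCommRing 𝒜 ⋙ forget₂ CommRingCat RingCat) :=
  letI (U : (Opens (ProjectiveSpectrum.top 𝒜))ᵒᵖ) :
    Module ↑((structurePresheafInCommRing 𝒜 ⋙ forget₂ CommRingCat RingCat).obj U)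
      ↑((twistInAb 𝒜 I k).obj U) :=
    inferInstanceAs (Module ((structurePresheafInCommRing 𝒜).obj U)
      ((twistInType 𝒜 I k).obj.obj U))
  .ofPresheaf (twistInAb 𝒜 I k) fun _ _ _ _ _ => rfl

/-- The sheaf of modules on `Proj A` associated to the graded module `I(k)`, where `I` is a
homogeneous ideal of `A`: its sections over `U` are the families `s x ∈ A_x`, `x ∈ U`, that are
locally of the form `f / g` with `f ∈ I` and `g` homogeneous and `deg f = deg g + k`. -/
def twist : (Proj 𝒜).Modules where
  val := twistPresheaf 𝒜 I k
  isSheaf := (TopCat.Presheaf.isSheaf_iff_isSheaf_comp (forget AddCommGrpCat) _).2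
    (twistInType 𝒜 I k).2

end Twist

/-! ### Closed subschemes: codimension, stalk ideals, local complete intersections

A closed subscheme `D` of a scheme `X` is given by its ideal sheaf, a term of
`X.IdealSheafData`; thus `D ≤ E` says that the ideal sheaf of `D` is contained in the one of `E`,
that is, that the closed subscheme `D` contains the closed subscheme `E`. -/

section Subschemes

variable {X : Scheme.{u}}

/-- The codimension of a closed subscheme: the infimum of the codimensions of the closures of its
points (`⊤` for the empty subscheme). -/
def codim (D : X.IdealSheafData) : ℕ∞ :=
  ⨅ x ∈ D.support, Order.coheight (x : X)

/-- The stalk of the ideal sheaf of `D` at `x`, as an ideal of the local ring of `X` at `x`. -/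
def stalkIdeal (D : X.IdealSheafData) (x : X) : Ideal (X.presheaf.stalk x) :=
  ⨆ (U : X.affineOpens) (hx : x ∈ U.1), (D.ideal U).map (X.presheaf.germ U.1 x hx).hom

/-- `D` is a local complete intersection in `X` at `x`: the stalk of its ideal sheaf is generated
by a regular sequence. (The sequence is only asked to be weakly regular, which is the same when
`x ∈ D`, and which makes the condition hold at the points outside `D`.) -/
def IsLCIAt (D : X.IdealSheafData) (x : X) : Prop :=
  ∃ rs : List (X.presheaf.stalk x),
    RingTheory.Sequence.IsWeaklyRegular (X.presheaf.stalk x) rs ∧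
      Ideal.ofList rs = stalkIdeal D x

/-- `D` is generically a local complete intersection: it is one at the generic point of each of its
irreducible components, i.e. at the points of `D` that have no proper generization in `D`. -/
def IsGenericallyLCI (D : X.IdealSheafData) : Prop :=
  ∀ x ∈ D.support, (∀ z ∈ D.support, z ⤳ x → z = x) → IsLCIAt D x

/-- The first infinitesimal neighbourhood of `Y`: the closed subscheme whose ideal sheaf is the
square of the ideal sheaf of `Y`. -/
def firstInfinitesimalNeighbourhood (Y : X.IdealSheafData) : X.IdealSheafData := Y ^ 2

end Subschemes

/-! ### Cohen–Macaulay rings -/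

section CohenMacaulay

/-- The depth of a local ring: the supremum of the lengths of the regular sequences in its maximal
ideal. -/
def depth (A : Type u) [CommRing A] [IsLocalRing A] : ℕ∞ :=
  ⨆ (rs : List A) (_ : RingTheory.Sequence.IsRegular A rs ∧
    ∀ a ∈ rs, a ∈ IsLocalRing.maximalIdeal A), (rs.length : ℕ∞)

/-- A ring is Cohen–Macaulay if its localizations at maximal ideals have depth equal to their
dimension. -/
def IsCohenMacaulay (A : Type u) [CommRing A] : Prop :=
  ∀ (M : Ideal A) [M.IsMaximal],
    ringKrullDim (Localization.AtPrime M) = (depth (Localization.AtPrime M) : WithBot ℕ∞)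

end CohenMacaulay

/-! ### Projective space -/

section ProjectiveSpace

variable (K : Type u) [Field K] (r : ℕ)

/-- The homogeneous coordinate ring `K[x_0, …, x_r]`. -/
abbrev CoordRing : Type u := MvPolynomial (Fin (r + 1)) K

/-- The grading of `K[x_0, …, x_r]` by the degree. -/
abbrev grading : ℕ → Submodule K (CoordRing K r) :=
  MvPolynomial.homogeneousSubmodule (Fin (r + 1)) K

/-- The projective space of dimension `r` over `K`. -/
abbrev ProjSpace : Scheme.{u} := Proj (grading K r)

variable {K r}

/-- The standard affine open `x_i ≠ 0`. -/
def chart (i : Fin (r + 1)) : (ProjSpace K r).affineOpens :=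
  ⟨Proj.basicOpen (grading K r) (MvPolynomial.X i),
    Proj.isAffineOpen_basicOpen (grading K r) _ (MvPolynomial.isHomogeneous_X K i) zero_lt_one⟩

/-- The section `f / x_i ^ n` of the structure sheaf over `x_i ≠ 0`, for `f` of degree `n`. -/
def dehomogenize (i : Fin (r + 1)) (n : ℕ) (f : CoordRing K r) (hf : f ∈ grading K r n) :
    Γ(ProjSpace K r, (chart (K := K) i).1) :=
  (Proj.awayToSection (grading K r) (MvPolynomial.X i)).hom
    (HomogeneousLocalization.Away.mk (grading K r) (MvPolynomial.isHomogeneous_X K i) n f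
      (by simpa using hf))

/-- The saturated homogeneous ideal `I_D = ⨁ₙ H⁰(ℙ^r, 𝓘_D(n))` of a closed subscheme `D` of
`ℙ^r`: it is generated by the forms `f`, of any degree `n`, for which every `f / x_i ^ n` lies in
the ideal sheaf of `D`. -/
def satIdeal (D : (ProjSpace K r).IdealSheafData) : Ideal (CoordRing K r) :=
  Ideal.span {f | ∃ (n : ℕ) (hf : f ∈ grading K r n),
    ∀ i, dehomogenize i n f hf ∈ D.ideal (chart i)}

/-- `D` is arithmetically Cohen–Macaulay. -/
def IsACM (D : (ProjSpace K r).IdealSheafData) : Prop :=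
  IsCohenMacaulay (CoordRing K r ⧸ satIdeal D)

variable (K r) in
/-- The invertible sheaf `𝒪(a)` on `ℙ^r`. -/
def O (a : ℤ) : (ProjSpace K r).Modules := twist (grading K r) ⊤ a

/-- The twisted ideal sheaf `𝓘_D(k)`: the sheaf associated to the graded module `I_D(k)`. -/
def idealSheaf (D : (ProjSpace K r).IdealSheafData) (k : ℤ) : (ProjSpace K r).Modules :=
  twist (grading K r) (satIdeal D) k

/-- `D` is obtained from the sheaf `N` by the construction in codimension `2`: there are a
dissocié sheaf `P = ⨁ 𝒪(a_i)` (i.e. a torsion-free coherent sheaf of projective dimension `0`),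
an integer `k` and a short exact sequence `0 ⟶ P ⟶ N ⟶ 𝓘_D(k) ⟶ 0`. -/
def IsObtainedFrom (N : (ProjSpace K r).Modules) (D : (ProjSpace K r).IdealSheafData) : Prop :=
  ∃ (n : ℕ) (a : Fin n → ℤ) (k : ℤ)
    (γ : (⨁ fun i => O K r (a i)) ⟶ N) (π : N ⟶ idealSheaf D k) (w : γ ≫ π = 0),
    (ShortComplex.mk γ π w).ShortExact

end ProjectiveSpace

end

end ACMConstruction

/-!
Write `I` and `J` for the saturated ideals of `Y` and `D`. The structure of `D` is that
`J = α I + β I` for two coprime forms `α, β ∈ I` of the same degree (`exists_eq_combIdeal`).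

The sheaves in the short exact sequence are subsheaves of constant sheaves on an integral scheme, so
that each morphism between two of them is the multiplication by an element of the fraction field of
the coordinate ring (`exists_mul`), and the sequence is given by a row `(α, β)` and columns
`(f i, g i)` over that field (`exists_matrices`). All these elements are regular away from the zero
locus of `I`, which contains no hypersurface, and are therefore forms
(`exists_polynomial_of_mem_Fr`). As `(α, β)` is locally surjective onto `J`, a common prime factor
of `α` and `β` would define a hypersurface in the zero locus of `J`; hence `α` and `β` are coprime.
The kernel of `(α, β)` then consists of multiples of the Koszul syzygy `(β, -α)`, the sum
`⨁ 𝒪(a i)` has a single summand, and its generator is a unit times the Koszul syzygy. The latter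
consequently has its entries in `I` (`mem_of_syzygies`). Finally `α I + β I` is saturated, since two
coprime polynomials in at least three variables generate a saturated ideal
(`exists_eq_of_X_pow_mul`), and so it equals `J`.

From `J = α I + β I` with `α, β ∈ I` it is clear that `J ≤ I ^ 2`, and that the same holds for the
ideal sheaves.

At a point of `Y`, the stalk of the ideal sheaf of `D` is `α I' + β I'` for a proper ideal `I'` of a
local domain, with `α, β ∈ I'` having only Koszul syzygies, and no regular sequence generates such
an ideal (`ofList_ne_combIdeal`). With at most two generators, `I' × I'` would be generated by lifts
of these and by `(β, -α)`, hence by three elements, so that `I'` would be principal by Nakayama's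
lemma; this contradicts the coprimality of `α` and `β` (`not_le_span_pair`). The first three
elements `x₁, x₂, x₃` of a longer regular sequence would satisfy `Δ x₃ ∈ (x₁, x₂)`, where `Δ` is the
determinant of the coefficients of `x₁` and `x₂`, and regularity would lead to `1 ∈ I'`
(`not_isWeaklyRegular_of_mem`).

A generic point of a component of `Y` of codimension two lies in `D`, and is a generic point of a
component of `D`, as `D` has codimension two as well. So `D` is not a local complete intersection
there.
-/

namespace ACMConstruction

noncomputable section

/-! ### Values of sections of the sheaf associated to `I(k)` -/

section Values

variable {A σ : Type u} [CommRing A] [SetLike σ A] [AddSubgroupClass σ A]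
variable {𝒜 : ℕ → σ} [GradedRing 𝒜] {I J : Ideal A} {k l : ℤ}

/-- The value at a point of a section of the sheaf associated to `I(k)`. -/
def ev {U : (Proj 𝒜).Opens} (s : Γ(twist 𝒜 I k, U)) (x : Proj 𝒜) (hx : x ∈ U) : LocAt 𝒜 x :=
  s.1 ⟨x, hx⟩

theorem ev_ext {U : (Proj 𝒜).Opens} {s t : Γ(twist 𝒜 I k, U)}
    (h : ∀ x hx, ev s x hx = ev t x hx) : s = t :=
  Subtype.ext (funext fun x => h x.1 x.2)

theorem ev_zero {U : (Proj 𝒜).Opens} (x : Proj 𝒜) (hx : x ∈ U) :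
    ev (0 : Γ(twist 𝒜 I k, U)) x hx = 0 := rfl

theorem ev_add {U : (Proj 𝒜).Opens} (s t : Γ(twist 𝒜 I k, U)) (x : Proj 𝒜) (hx : x ∈ U) :
    ev (s + t) x hx = ev s x hx + ev t x hx := rfl

/-- The value at a point of a section of the structure sheaf, in the localization `A_x`. -/
def evO {U : (Proj 𝒜).Opens} (t : Γ(Proj 𝒜, U)) (x : Proj 𝒜) (hx : x ∈ U) : LocAt 𝒜 x :=
  HomogeneousLocalization.val (Subtype.val
    (p := fun s => s ∈ ProjectiveSpectrum.StructureSheaf.sectionsSubring (𝒜 := 𝒜) (op U))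
    t ⟨x, hx⟩)

theorem ev_smul {U : (Proj 𝒜).Opens} (t : Γ(Proj 𝒜, U)) (s : Γ(twist 𝒜 I k, U)) (x : Proj 𝒜)
    (hx : x ∈ U) : ev (t • s) x hx = evO t x hx * ev s x hx := rfl

theorem ev_frac {U : (Proj 𝒜).Opens} (s : Γ(twist 𝒜 I k, U)) (x : Proj 𝒜) (hx : x ∈ U) :
    ∃ (i j : ℕ) (f g : A), f ∈ 𝒜 i ∧ f ∈ I ∧ g ∈ 𝒜 j ∧ (i : ℤ) = j + k ∧
      ∃ V : (Proj 𝒜).Opens, x ∈ V ∧ V ≤ U ∧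
        ∀ (y : ProjectiveSpectrum.top 𝒜) (_ : y ∈ V) (hU : y ∈ U),
          ∃ hg : g ∈ (ProjectiveSpectrum.asHomogeneousIdeal y).toIdeal.primeCompl,
            ev s y hU = Localization.mk f ⟨g, hg⟩ := by
  obtain ⟨V, hxV, i, a, b, f, g, h1, h2, h3, h4, h5⟩ := s.2 ⟨x, hx⟩
  exact ⟨a, b, f, g, h1, h2, h3, h4, V, hxV, i.le, fun y hy _ => h5 ⟨y, hy⟩⟩

/-- The fraction `f / g`, as a section of the sheaf associated to `I(k)`. -/
def fracSec (U : (Proj 𝒜).Opens) (i j : ℕ) (f g : A) (hf : f ∈ 𝒜 i) (hfI : f ∈ I) (hg : g ∈ 𝒜 j)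
    (hij : (i : ℤ) = j + k) (hU : U ≤ Proj.basicOpen 𝒜 g) : Γ(twist 𝒜 I k, U) :=
  (⟨fun x => Localization.mk f ⟨g, hU x.2⟩, fun x => ⟨U, x.2, 𝟙 _, i, j, f, g, hf, hfI, hg, hij,
    fun y => ⟨hU y.2, rfl⟩⟩⟩ : (twistInType 𝒜 I k).obj.obj (op U))

/-- The fraction `f / g` of degree zero, as a regular function. -/
def fracO (U : (Proj 𝒜).Opens) (i : ℕ) (f g : A) (hf : f ∈ 𝒜 i) (hg : g ∈ 𝒜 i)
    (hU : U ≤ Proj.basicOpen 𝒜 g) : Γ(Proj 𝒜, U) :=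
  (⟨fun x => .mk ⟨i, ⟨f, hf⟩, ⟨g, hg⟩, hU x.2⟩, fun x => ⟨U, x.2, 𝟙 _, i, ⟨f, hf⟩, ⟨g, hg⟩,
    fun y => hU y.2, fun _ => rfl⟩⟩ :
      (ProjectiveSpectrum.StructureSheaf.structureSheafInType 𝒜).obj.obj (op U))

theorem app_map (φ : twist 𝒜 I k ⟶ twist 𝒜 J l) {U V : (Proj 𝒜).Opens} (i : V ⟶ U)
    (s : Γ(twist 𝒜 I k, U)) :
    φ.app V ((twist 𝒜 I k).presheaf.map i.op s) = (twist 𝒜 J l).presheaf.map i.op (φ.app U s) :=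
  ConcreteCategory.congr_hom (φ.mapPresheaf.naturality i.op) s

/-- For `I ≤ J`, the inclusion of the sheaf associated to `I(k)` in the one associated to
`J(k)`. -/
def twistIncl (h : I ≤ J) : twist 𝒜 I k ⟶ twist 𝒜 J k :=
  ⟨PresheafOfModules.homMk
   { app := fun (U : (Opens (ProjectiveSpectrum.top 𝒜))ᵒᵖ) =>
       AddCommGrpCat.ofHom (X := (twistInType 𝒜 I k).obj.obj U)
         (Y := (twistInType 𝒜 J k).obj.obj U)
       { toFun := fun s => ⟨s.1, fun x => by
            obtain ⟨V, hxV, i, a, b, f, g, h1, h2, h3, h4, h5⟩ := s.2 x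
            exact ⟨V, hxV, i, a, b, f, g, h1, h h2, h3, h4, h5⟩⟩
         map_zero' := rfl
         map_add' := fun _ _ => rfl }
     naturality := fun _ _ _ => rfl } (fun _ _ _ => rfl)⟩

/-- A morphism to the sheaf associated to `J(l)` all of whose values are locally fractions with
numerator in `E`, as a morphism to the sheaf associated to `E(l)`. -/
def twistCodRestrict (φ : twist 𝒜 I k ⟶ twist 𝒜 J l) (E : Ideal A)
    (h : ∀ (U : (Proj 𝒜).Opens) (s : Γ(twist 𝒜 I k, U)),
      (isLocallyTwistFraction 𝒜 E l).pred (U := U) (fun x => ev (φ.app U s) x.1 x.2)) :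
    twist 𝒜 I k ⟶ twist 𝒜 E l :=
  ⟨PresheafOfModules.homMk
   { app := fun (U : (Opens (ProjectiveSpectrum.top 𝒜))ᵒᵖ) =>
       AddCommGrpCat.ofHom (X := (twistInType 𝒜 I k).obj.obj U)
         (Y := (twistInType 𝒜 E l).obj.obj U)
       { toFun := fun s => ⟨fun x => ev (φ.app U.unop s) x.1 x.2, h U.unop s⟩
         map_zero' := ev_ext (U := U.unop) fun x hx =>
           congr(ev $(map_zero (φ.app U.unop).hom) x hx)
         map_add' := fun s t => ev_ext (U := U.unop) fun x hx =>
           congr(ev $(map_add (φ.app U.unop).hom s t) x hx) }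
     naturality := fun U V i => by
       ext s
       refine ev_ext (U := V.unop) fun x hx => ?_
       exact congr(ev $(app_map φ i.unop s) x hx) }
    (fun U r s => ev_ext (U := U.unop) fun x hx =>
      congr(ev $(Scheme.Modules.Hom.app_smul φ (U := U.unop) r s) x hx))⟩

end Values

/-! ### Sections as elements of the fraction field -/

section FractionField

variable {A σ : Type u} [CommRing A] [SetLike σ A] [AddSubgroupClass σ A]
variable {𝒜 : ℕ → σ} [GradedRing 𝒜] {I J : Ideal A} {k l : ℤ}

theorem algebraMap_ne_zero {f : A} (hf : f ≠ 0) : algebraMap A (FractionRing A) f ≠ 0 :=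
  (map_ne_zero_iff _ (IsFractionRing.injective A (FractionRing A))).2 hf

theorem ne_zero_of_notMem {x : Proj 𝒜} {f : A} (hf : f ∉ x.asHomogeneousIdeal) : f ≠ 0 :=
  fun h => hf (h ▸ zero_mem _)

theorem mul_notMem {x : Proj 𝒜} {f g : A} (hf : f ∉ x.asHomogeneousIdeal)
    (hg : g ∉ x.asHomogeneousIdeal) : f * g ∉ x.asHomogeneousIdeal :=
  fun h => ((ProjectiveSpectrum.isPrime x).mem_or_mem h).elim hf hg

variable [IsDomain A]

/-- The embedding of the local ring `A_x` into the fraction field of `A`. -/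
def toF (x : ProjectiveSpectrum.top 𝒜) : LocAt 𝒜 x →+* FractionRing A :=
  IsLocalization.lift (M := x.asHomogeneousIdeal.toIdeal.primeCompl)
    (g := algebraMap A (FractionRing A)) fun y =>
      (map_ne_zero_iff _ (IsFractionRing.injective A (FractionRing A))).2
        (fun h => y.2 (by rw [h]; exact zero_mem _)) |>.isUnit

theorem toF_mk (x : ProjectiveSpectrum.top 𝒜) (f : A)
    (g : (ProjectiveSpectrum.asHomogeneousIdeal x).toIdeal.primeCompl) :
    toF x (Localization.mk f g) =
      algebraMap A (FractionRing A) f / algebraMap A (FractionRing A) g := by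
  have hg : algebraMap A (FractionRing A) g ≠ 0 :=
    (map_ne_zero_iff _ (IsFractionRing.injective A (FractionRing A))).2
        (fun h => g.2 (h ▸ zero_mem _))
  rw [toF, Localization.mk_eq_mk', IsLocalization.lift_mk'_spec, mul_div_cancel₀ _ hg]

theorem toF_injective (x : ProjectiveSpectrum.top 𝒜) : Function.Injective (toF x) := by
  rw [injective_iff_map_eq_zero]
  intro z
  induction z using Localization.induction_on with
  | H y =>
    rw [toF_mk]
    intro h
    have hg : algebraMap A (FractionRing A) y.2 ≠ 0 :=
      (map_ne_zero_iff _ (IsFractionRing.injective A (FractionRing A))).2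
        (fun h => y.2.2 (h ▸ zero_mem _))
    rw [div_eq_zero_iff, or_iff_left hg, map_eq_zero_iff _ (IsFractionRing.injective A _)] at h
    rw [h, Localization.mk_zero]

/-- The value of a section of the sheaf associated to `I(k)`, in the fraction field of `A`. -/
def evF {U : (Proj 𝒜).Opens} (s : Γ(twist 𝒜 I k, U)) (x : Proj 𝒜) (hx : x ∈ U) : FractionRing A :=
  toF x (ev s x hx)

variable (𝒜) in
/-- The stalk at `x` of the sheaf associated to `I(k)`, as a subset of the fraction field of `A`:
the fractions `f / g` of degree `k` with `f ∈ I` and `g` not vanishing at `x`. -/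
def Fr (I : Ideal A) (k : ℤ) (x : Proj 𝒜) : Set (FractionRing A) :=
  {q | ∃ (i j : ℕ) (f g : A), f ∈ 𝒜 i ∧ f ∈ I ∧ g ∈ 𝒜 j ∧ (i : ℤ) = j + k ∧
    g ∉ x.asHomogeneousIdeal ∧
      q = algebraMap A (FractionRing A) f / algebraMap A (FractionRing A) g}

theorem evF_ext {U : (Proj 𝒜).Opens} {s t : Γ(twist 𝒜 I k, U)}
    (h : ∀ x hx, evF s x hx = evF t x hx) : s = t :=
  ev_ext fun x hx => toF_injective x (h x hx)

theorem evF_zero {U : (Proj 𝒜).Opens} (x : Proj 𝒜) (hx : x ∈ U) :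
    evF (0 : Γ(twist 𝒜 I k, U)) x hx = 0 := (congrArg _ (ev_zero x hx)).trans (map_zero _)

theorem evF_add {U : (Proj 𝒜).Opens} (s t : Γ(twist 𝒜 I k, U)) (x : Proj 𝒜) (hx : x ∈ U) :
    evF (s + t) x hx = evF s x hx + evF t x hx :=
  (congrArg _ (ev_add s t x hx)).trans (map_add _ _ _)

theorem evF_map {U V : (Proj 𝒜).Opens} (i : V ⟶ U) (s : Γ(twist 𝒜 I k, U)) (x : Proj 𝒜)
    (hx : x ∈ V) : evF ((twist 𝒜 I k).presheaf.map i.op s) x hx = evF s x (i.le hx) := rfl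

/-- The value of a regular function, in the fraction field of `A`. -/
def evOF {U : (Proj 𝒜).Opens} (t : Γ(Proj 𝒜, U)) (x : Proj 𝒜) (hx : x ∈ U) : FractionRing A :=
  toF x (evO t x hx)

theorem evF_smul {U : (Proj 𝒜).Opens} (t : Γ(Proj 𝒜, U)) (s : Γ(twist 𝒜 I k, U)) (x : Proj 𝒜)
    (hx : x ∈ U) : evF (t • s) x hx = evOF t x hx * evF s x hx :=
  (congrArg _ (ev_smul t s x hx)).trans (map_mul _ _ _)

theorem exists_section_eq_div (U : (Proj 𝒜).Opens) (i j : ℕ) (f g : A) (hf : f ∈ 𝒜 i) (hfI : f ∈ I)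
    (hg : g ∈ 𝒜 j) (hij : (i : ℤ) = j + k) (hU : U ≤ Proj.basicOpen 𝒜 g) :
    ∃ s : Γ(twist 𝒜 I k, U), ∀ x hx, evF s x hx =
      algebraMap A (FractionRing A) f / algebraMap A (FractionRing A) g :=
  ⟨fracSec U i j f g hf hfI hg hij hU, fun _ _ => toF_mk _ _ _⟩

theorem exists_function_eq_div (U : (Proj 𝒜).Opens) (i : ℕ) (f g : A) (hf : f ∈ 𝒜 i)
    (hg : g ∈ 𝒜 i) (hU : U ≤ Proj.basicOpen 𝒜 g) :
    ∃ t : Γ(Proj 𝒜, U), ∀ x hx, evOF t x hx =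
      algebraMap A (FractionRing A) f / algebraMap A (FractionRing A) g :=
  ⟨fracO U i f g hf hg hU, fun _ _ => toF_mk _ _ _⟩

theorem evF_frac {U : (Proj 𝒜).Opens} (s : Γ(twist 𝒜 I k, U)) (x : Proj 𝒜) (hx : x ∈ U) :
    ∃ (i j : ℕ) (f g : A), f ∈ 𝒜 i ∧ f ∈ I ∧ g ∈ 𝒜 j ∧ (i : ℤ) = j + k ∧
      ∃ V : (Proj 𝒜).Opens, x ∈ V ∧ V ≤ U ∧ V ≤ Proj.basicOpen 𝒜 g ∧
        ∀ (y : Proj 𝒜) (_ : y ∈ V) (hU : y ∈ U), evF s y hU =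
          algebraMap A (FractionRing A) f / algebraMap A (FractionRing A) g := by
  obtain ⟨i, j, f, g, hf, hfI, hg, hij, V, hxV, hVU, h⟩ := ev_frac s x hx
  refine ⟨i, j, f, g, hf, hfI, hg, hij, V, hxV, hVU, fun y hy => (h y hy (hVU hy)).1,
    fun y hy hU => ?_⟩
  obtain ⟨h1, h2⟩ := h y hy hU
  exact (congrArg _ h2).trans (toF_mk _ _ _)

theorem evF_mem_Fr {U : (Proj 𝒜).Opens} (s : Γ(twist 𝒜 I k, U)) (x : Proj 𝒜) (hx : x ∈ U) :
    evF s x hx ∈ Fr 𝒜 I k x := by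
  obtain ⟨i, j, f, g, hf, hfI, hg, hij, V, hxV, hVU, hVg, h⟩ := evF_frac s x hx
  exact ⟨i, j, f, g, hf, hfI, hg, hij, hVg hxV, h x hxV hx⟩

/-- The generic point of `Proj A`, which exists as soon as `Proj A` has a point. -/
def genPt (x : Proj 𝒜) : Proj 𝒜 :=
  (⟨⊥, Ideal.isPrime_bot, fun h => x.not_irrelevant_le (h.trans bot_le)⟩ : ProjectiveSpectrum 𝒜)

theorem mem_genPt_iff (x : Proj 𝒜) (f : A) : f ∈ (genPt x).asHomogeneousIdeal ↔ f = 0 :=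
  Ideal.mem_bot

theorem genPt_mem (x : Proj 𝒜) {y : Proj 𝒜} {U : (Proj 𝒜).Opens} (hy : y ∈ U) :
    genPt x ∈ U := by
  obtain ⟨_, ⟨f, rfl⟩, hf, hfU⟩ :=
    (ProjectiveSpectrum.isTopologicalBasis_basic_opens 𝒜).exists_subset_of_mem_open
      (show y ∈ (U : Set (Proj 𝒜)) from hy) U.2
  refine hfU ?_
  intro h
  rw [(mem_genPt_iff x f).1 h] at hf
  exact hf (zero_mem _)

theorem evF_eq_genPt {U : (Proj 𝒜).Opens} (s : Γ(twist 𝒜 I k, U)) (z x : Proj 𝒜) (hx : x ∈ U) :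
    evF s x hx = evF s (genPt z) (genPt_mem z hx) := by
  obtain ⟨i, j, f, g, hf, hfI, hg, hij, V, hxV, hVU, hVg, h⟩ := evF_frac s x hx
  rw [h x hxV hx, h _ (genPt_mem z hxV)]

/-- Every morphism between the sheaves associated to two graded ideals is the multiplication by an
element of the fraction field. -/
theorem exists_mul (φ : twist 𝒜 I k ⟶ twist 𝒜 J l) :
    ∃ α : FractionRing A, ∀ (U : (Proj 𝒜).Opens) (s : Γ(twist 𝒜 I k, U)) (x : Proj 𝒜) (hx : x ∈ U),
      evF (φ.app U s) x hx = α * evF s x hx := by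
  by_cases H : ∃ (U₀ : (Proj 𝒜).Opens) (s₀ : Γ(twist 𝒜 I k, U₀)) (x₀ : Proj 𝒜) (hx₀ : x₀ ∈ U₀),
      evF s₀ x₀ hx₀ ≠ 0
  · obtain ⟨U₀, s₀, x₀, hx₀, h₀⟩ := H
    refine ⟨evF (φ.app U₀ s₀) x₀ hx₀ / evF s₀ x₀ hx₀, fun U s x hx => ?_⟩
    obtain ⟨i₀, j₀, f₀, g₀, hf₀, hfI₀, hg₀, hij₀, V₀, hxV₀, hVU₀, hVg₀, hv₀⟩ := evF_frac s₀ x₀ hx₀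
    obtain ⟨i, j, f, g, hf, hfI, hg, hij, V, hxV, hVU, hVg, hv⟩ := evF_frac s x hx
    have hf₀' : f₀ ≠ 0 := by
      rintro rfl
      rw [hv₀ x₀ hxV₀, map_zero, zero_div] at h₀
      exact h₀ rfl
    let W : (Proj 𝒜).Opens := V ⊓ V₀ ⊓ Proj.basicOpen 𝒜 f₀
    have hW : genPt x ∈ W := ⟨⟨genPt_mem x hxV, genPt_mem x hxV₀⟩,
      fun h => hf₀' ((mem_genPt_iff x f₀).1 h)⟩
    have hWU : W ≤ U := fun y hy => hVU hy.1.1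
    have hWU₀ : W ≤ U₀ := fun y hy => hVU₀ hy.1.2
    obtain ⟨t, ht⟩ := exists_function_eq_div W (i + j₀) (f * g₀) (g * f₀)
      (SetLike.mul_mem_graded hf hg₀)
      (by
        have : i + j₀ = j + i₀ := by omega
        rw [this]
        exact SetLike.mul_mem_graded hg hf₀)
      (fun y hy h => ((ProjectiveSpectrum.isPrime y).mem_or_mem h).elim (hVg hy.1.1) hy.2)
    have key : (twist 𝒜 I k).presheaf.map (homOfLE hWU).op s =
        t • (twist 𝒜 I k).presheaf.map (homOfLE hWU₀).op s₀ := by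
      refine evF_ext fun y hy => ?_
      rw [evF_smul, evF_map, evF_map, ht, hv y hy.1.1, hv₀ y hy.1.2]
      have h1 : algebraMap A (FractionRing A) g₀ ≠ 0 :=
        algebraMap_ne_zero fun h => hVg₀ hy.1.2 (h ▸ zero_mem _)
      have h2 := algebraMap_ne_zero hf₀'
      have h3 : algebraMap A (FractionRing A) g ≠ 0 :=
        algebraMap_ne_zero fun h => hVg hy.1.1 (h ▸ zero_mem _)
      rw [map_mul, map_mul]
      field_simp
    have key2 := congrArg (fun z => evF (φ.app W z) (genPt x) hW) key
    simp only [Scheme.Modules.Hom.app_smul, app_map, evF_smul, evF_map] at key2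
    rw [← evF_eq_genPt (φ.app U s) x x hx, ← evF_eq_genPt (φ.app U₀ s₀) x x₀ hx₀] at key2
    rw [key2, ht, hv x hxV, hv₀ x₀ hxV₀]
    rw [map_mul, map_mul]
    field_simp
  · push Not at H
    refine ⟨0, fun U s x hx => ?_⟩
    have : s = 0 := evF_ext fun y hy => (H U s y hy).trans (evF_zero y hy).symm
    rw [this, map_zero, evF_zero, evF_zero, mul_zero]

theorem mul_mem_Fr {φ : twist 𝒜 I k ⟶ twist 𝒜 J l} {α : FractionRing A}
    (hα : ∀ (U : (Proj 𝒜).Opens) (s : Γ(twist 𝒜 I k, U)) (x : Proj 𝒜) (hx : x ∈ U),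
      evF (φ.app U s) x hx = α * evF s x hx) {x : Proj 𝒜} {q : FractionRing A}
    (hq : q ∈ Fr 𝒜 I k x) : α * q ∈ Fr 𝒜 J l x := by
  obtain ⟨i, j, f, g, hf, hfI, hg, hij, hgx, rfl⟩ := hq
  obtain ⟨s, hs⟩ := exists_section_eq_div (Proj.basicOpen 𝒜 g) i j f g hf hfI hg hij le_rfl
  have hgx' : x ∈ Proj.basicOpen 𝒜 g := hgx
  rw [← hs x hgx', ← hα _ s x hgx']
  exact evF_mem_Fr _ _ _

end FractionField

/-! ### Short exact sequences of sheaves of modules, on sections -/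

section Sections

variable {X : Scheme.{u}}

/-- The sections over `U`, as a functor to abelian groups. -/
def sectionsOver (U : X.Opens) : X.Modules ⥤ Ab.{u} :=
  Scheme.Modules.toPresheaf X ⋙ (evaluation _ _).obj (op U)

instance (U : X.Opens) : PreservesFiniteLimits (sectionsOver U) :=
  have : PreservesFiniteLimits ((evaluation (Opens X)ᵒᵖ Ab.{u}).obj (op U)) :=
    ⟨fun _ _ _ => inferInstance⟩
  comp_preservesFiniteLimits (Scheme.Modules.toPresheaf X) ((evaluation _ _).obj (op U))

instance (U : X.Opens) : (sectionsOver U).PreservesZeroMorphisms where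
  map_zero _ _ := rfl

theorem app_injective_of_mono {M N : X.Modules} (φ : M ⟶ N) [Mono φ] (U : X.Opens) :
    Function.Injective (φ.app U) :=
  (AddCommGrpCat.mono_iff_injective _).1 (inferInstanceAs (Mono ((sectionsOver U).map φ)))

theorem mono_of_app_injective {M N : X.Modules} (φ : M ⟶ N)
    (h : ∀ U, Function.Injective (φ.app U)) : Mono φ where
  right_cancellation a b hab := by
    ext U s
    apply h U
    exact ConcreteCategory.congr_hom (congrArg (fun z => Scheme.Modules.Hom.app z U) hab) s

theorem exists_app_eq_of_shortExact {S : ShortComplex X.Modules} (hS : S.ShortExact)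
    (U : X.Opens) (s : Γ(S.X₂, U)) (hs : S.g.app U s = 0) : ∃ t, S.f.app U t = s := by
  have := hS.mono_f
  have h := hS.exact.map_of_mono_of_preservesKernel (sectionsOver U) inferInstance inferInstance
  rw [ShortComplex.ab_exact_iff] at h
  exact h s hs

theorem surjective_of_mono_of_epi {M N : X.Modules} (φ : M ⟶ N) [Mono φ] [Epi φ] (U : X.Opens) :
    Function.Surjective (φ.app U) := by
  have : IsIso φ := isIso_of_mono_of_epi φ
  exact (ConcreteCategory.bijective_of_isIso (φ.app U)).2

theorem sum_app {M N : X.Modules} {ι : Type*} (s : Finset ι) (φ : ι → (M ⟶ N)) (U : X.Opens)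
    (x : Γ(M, U)) : (∑ i ∈ s, φ i).app U x = ∑ i ∈ s, (φ i).app U x := by
  classical
  induction s using Finset.induction with
  | empty => rfl
  | insert a s ha ih => rw [Finset.sum_insert ha, Finset.sum_insert ha, ← ih]; rfl

theorem comp_app_apply {M N P : X.Modules} (φ : M ⟶ N) (ψ : N ⟶ P) (U : X.Opens) (x : Γ(M, U)) :
    (φ ≫ ψ).app U x = ψ.app U (φ.app U x) := rfl

theorem biprod_section_eq {M N : X.Modules} (U : X.Opens) (z : Γ(M ⊞ N, U)) :
    z = Scheme.Modules.Hom.app (biprod.inl : M ⟶ M ⊞ N) U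
          (Scheme.Modules.Hom.app (biprod.fst : M ⊞ N ⟶ M) U z) +
        Scheme.Modules.Hom.app (biprod.inr : N ⟶ M ⊞ N) U
          (Scheme.Modules.Hom.app (biprod.snd : M ⊞ N ⟶ N) U z) :=
  congrArg (fun φ => Scheme.Modules.Hom.app φ U z) (biprod.total (X := M) (Y := N)).symm

theorem biprod_section_ext {M N : X.Modules} (U : X.Opens) (s t : Γ(M ⊞ N, U))
    (h₁ : Scheme.Modules.Hom.app (biprod.fst : M ⊞ N ⟶ M) U s =
      Scheme.Modules.Hom.app (biprod.fst : M ⊞ N ⟶ M) U t)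
    (h₂ : Scheme.Modules.Hom.app (biprod.snd : M ⊞ N ⟶ N) U s =
      Scheme.Modules.Hom.app (biprod.snd : M ⊞ N ⟶ N) U t) : s = t := by
  rw [biprod_section_eq U s, biprod_section_eq U t, h₁, h₂]

theorem exists_biprod_section {M N : X.Modules} (U : X.Opens) (s : Γ(M, U)) (t : Γ(N, U)) :
    ∃ z : Γ(M ⊞ N, U), Scheme.Modules.Hom.app (biprod.fst : M ⊞ N ⟶ M) U z = s ∧
      Scheme.Modules.Hom.app (biprod.snd : M ⊞ N ⟶ N) U z = t := by
  refine ⟨Scheme.Modules.Hom.app (biprod.inl : M ⟶ M ⊞ N) U s +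
    Scheme.Modules.Hom.app (biprod.inr : N ⟶ M ⊞ N) U t, ?_, ?_⟩
  · rw [map_add, ← comp_app_apply, ← comp_app_apply, biprod.inl_fst, biprod.inr_fst]
    exact add_zero s
  · rw [map_add, ← comp_app_apply, ← comp_app_apply, biprod.inl_snd, biprod.inr_snd]
    exact zero_add t

theorem biprod_app_eq {M N P : X.Modules} (π : M ⊞ N ⟶ P) (U : X.Opens) (z : Γ(M ⊞ N, U)) :
    π.app U z =
      (biprod.inl ≫ π).app U (Scheme.Modules.Hom.app (biprod.fst : M ⊞ N ⟶ M) U z) +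
      (biprod.inr ≫ π).app U (Scheme.Modules.Hom.app (biprod.snd : M ⊞ N ⟶ N) U z) := by
  conv_lhs => rw [biprod_section_eq U z]
  rw [map_add]
  rfl

theorem biproduct_app_eq {n : ℕ} {L : Fin n → X.Modules} {P : X.Modules} (γ : ⨁ L ⟶ P)
    (U : X.Opens) (z : Γ(⨁ L, U)) :
    γ.app U z = ∑ i, (biproduct.ι L i ≫ γ).app U
      (Scheme.Modules.Hom.app (biproduct.π L i) U z) := by
  have h : γ = ∑ i, biproduct.π L i ≫ biproduct.ι L i ≫ γ := by
    simp_rw [← Category.assoc]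
    rw [← Preadditive.sum_comp, biproduct.total, Category.id_comp]
  conv_lhs => rw [h]
  rw [sum_app]
  rfl

theorem eq_zero_of_biproduct_mono {n : ℕ} {L : Fin n → X.Modules} {P : X.Modules} (γ : ⨁ L ⟶ P)
    [Mono γ] (U : X.Opens) {i j : Fin n} (hij : i ≠ j) (s : Γ(L i, U)) (t : Γ(L j, U))
    (h : (biproduct.ι L i ≫ γ).app U s + (biproduct.ι L j ≫ γ).app U t = 0) : s = 0 := by
  rw [comp_app_apply, comp_app_apply, ← map_add] at h
  have h' := congrArg (Scheme.Modules.Hom.app (biproduct.π L i) U)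
    (app_injective_of_mono γ U (h.trans (map_zero _).symm))
  rw [map_add, map_zero, ← comp_app_apply, ← comp_app_apply, biproduct.ι_π_self,
    biproduct.ι_π_ne L hij.symm] at h'
  exact (add_zero s).symm.trans h'

end Sections

/-! ### The algebraic content of the short exact sequence -/

section Extraction

variable {A σ : Type u} [CommRing A] [SetLike σ A] [AddSubgroupClass σ A] [IsDomain A]
variable {𝒜 : ℕ → σ} [GradedRing 𝒜] {I J : Ideal A} {k l : ℤ}

theorem evF_sum {U : (Proj 𝒜).Opens} {ι : Type*} (S : Finset ι) (s : ι → Γ(twist 𝒜 I k, U))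
    (x : Proj 𝒜) (hx : x ∈ U) : evF (∑ i ∈ S, s i) x hx = ∑ i ∈ S, evF (s i) x hx := by
  classical
  induction S using Finset.induction with
  | empty => exact evF_zero x hx
  | insert a S ha ih => rw [Finset.sum_insert ha, Finset.sum_insert ha, ← ih, evF_add]

theorem pred_of_mul_mem_Fr (φ : twist 𝒜 I k ⟶ twist 𝒜 J l) {α : FractionRing A}
    (hα : ∀ (U : (Proj 𝒜).Opens) (s : Γ(twist 𝒜 I k, U)) (x : Proj 𝒜) (hx : x ∈ U),
      evF (φ.app U s) x hx = α * evF s x hx) {E : Ideal A}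
    (hE : ∀ (x : Proj 𝒜), ∀ q ∈ Fr 𝒜 I k x, α * q ∈ Fr 𝒜 E l x)
    (U : (Proj 𝒜).Opens) (s : Γ(twist 𝒜 I k, U)) :
    (isLocallyTwistFraction 𝒜 E l).pred (U := U) (fun x => ev (φ.app U s) x.1 x.2) := by
  rintro ⟨x, hx⟩
  obtain ⟨i, j, f, g, hf, hfI, hg, hij, V, hxV, hVU, hVg, hv⟩ := evF_frac s x hx
  obtain ⟨i', j', f', g', hf', hfE', hg', hij', hgx', he⟩ := hE x _ (evF_mem_Fr s x hx)
  have hgx'' : x ∈ Proj.basicOpen 𝒜 g' := hgx'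
  refine ⟨V ⊓ Proj.basicOpen 𝒜 g', ⟨hxV, hgx''⟩, homOfLE (inf_le_left.trans hVU),
    i', j', f', g', hf', hfE', hg', hij', ?_⟩
  rintro ⟨y, hy⟩
  refine ⟨hy.2, toF_injective y ?_⟩
  have h1 : evF (φ.app U s) y (hVU hy.1) = α * evF s y (hVU hy.1) := hα U s y _
  rw [hv y hy.1, ← hv x hxV hx, he] at h1
  exact h1.trans (toF_mk (y : ProjectiveSpectrum.top 𝒜) f' ⟨g', hy.2⟩).symm

/-- Local surjectivity of an epimorphism `I(k) ⊞ I(k) ⟶ J(l)` given by `(α, β)`: it factors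
through the subsheaf associated to `E ≤ J` as soon as `α I` and `β I` lie in `E` locally, and then
the inclusion of this subsheaf is an epimorphism, hence an isomorphism. -/
theorem Fr_subset_of_epi (π : twist 𝒜 I k ⊞ twist 𝒜 I k ⟶ twist 𝒜 J l) [Epi π]
    {α β : FractionRing A}
    (hα : ∀ (U : (Proj 𝒜).Opens) (s : Γ(twist 𝒜 I k, U)) (x : Proj 𝒜) (hx : x ∈ U),
      evF ((biprod.inl ≫ π).app U s) x hx = α * evF s x hx)
    (hβ : ∀ (U : (Proj 𝒜).Opens) (s : Γ(twist 𝒜 I k, U)) (x : Proj 𝒜) (hx : x ∈ U),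
      evF ((biprod.inr ≫ π).app U s) x hx = β * evF s x hx)
    {E : Ideal A} (hEJ : E ≤ J) (hEα : ∀ (x : Proj 𝒜), ∀ q ∈ Fr 𝒜 I k x, α * q ∈ Fr 𝒜 E l x)
    (hEβ : ∀ (x : Proj 𝒜), ∀ q ∈ Fr 𝒜 I k x, β * q ∈ Fr 𝒜 E l x) (x : Proj 𝒜) :
    Fr 𝒜 J l x ⊆ Fr 𝒜 E l x := by
  have hfac : biprod.desc
      (twistCodRestrict (biprod.inl ≫ π) E (pred_of_mul_mem_Fr _ hα hEα))
      (twistCodRestrict (biprod.inr ≫ π) E (pred_of_mul_mem_Fr _ hβ hEβ)) ≫ twistIncl hEJ = π := by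
    apply biprod.hom_ext'
    · rw [biprod.inl_desc_assoc]
      ext U s
      exact ev_ext fun y hy => rfl
    · rw [biprod.inr_desc_assoc]
      ext U s
      exact ev_ext fun y hy => rfl
  have : Epi (twistIncl (𝒜 := 𝒜) (k := l) hEJ) := epi_of_epi_fac hfac
  have : Mono (twistIncl (𝒜 := 𝒜) (k := l) hEJ) := mono_of_app_injective _ fun U s t hst =>
    ev_ext fun y hy => by
      exact congrArg (fun z : Γ(twist 𝒜 J l, U) => ev z y hy) hst
  rintro q ⟨i, j, f, g, hf, hfJ, hg, hij, hgx, rfl⟩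
  have hgx' : x ∈ Proj.basicOpen 𝒜 g := hgx
  obtain ⟨s, hs⟩ := exists_section_eq_div (Proj.basicOpen 𝒜 g) i j f g hf hfJ hg hij le_rfl
  obtain ⟨t, ht⟩ := surjective_of_mono_of_epi (twistIncl (𝒜 := 𝒜) (k := l) hEJ) _ s
  rw [← hs x hgx', ← ht]
  exact evF_mem_Fr t x hgx'

/-- A short exact sequence `0 ⟶ ⨁ A(a i) ⟶ I(l) ⊞ I(l) ⟶ J(k) ⟶ 0` on `Proj A`, expressed in the
fraction field of `A`: its maps are matrices of elements of that field. -/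
theorem exists_matrices {n : ℕ} {a : Fin n → ℤ}
    (γ : (⨁ fun i => twist 𝒜 ⊤ (a i)) ⟶ twist 𝒜 I l ⊞ twist 𝒜 I l)
    (π : twist 𝒜 I l ⊞ twist 𝒜 I l ⟶ twist 𝒜 J k) (w : γ ≫ π = 0)
    (hS : (ShortComplex.mk γ π w).ShortExact) :
    ∃ (α β : FractionRing A) (f g : Fin n → FractionRing A),
      (∀ x, ∀ q ∈ Fr 𝒜 I l x, α * q ∈ Fr 𝒜 J k x) ∧
      (∀ x, ∀ q ∈ Fr 𝒜 I l x, β * q ∈ Fr 𝒜 J k x) ∧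
      (∀ i x, ∀ q ∈ Fr 𝒜 ⊤ (a i) x, f i * q ∈ Fr 𝒜 I l x) ∧
      (∀ i x, ∀ q ∈ Fr 𝒜 ⊤ (a i) x, g i * q ∈ Fr 𝒜 I l x) ∧
      (∀ i x, ∀ q ∈ Fr 𝒜 ⊤ (a i) x, α * (f i * q) + β * (g i * q) = 0) ∧
      (∀ x, ∀ u ∈ Fr 𝒜 I l x, ∀ v ∈ Fr 𝒜 I l x, α * u + β * v = 0 →
        ∃ c : Fin n → FractionRing A, (∀ i, c i ∈ Fr 𝒜 ⊤ (a i) x) ∧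
          u = ∑ i, f i * c i ∧ v = ∑ i, g i * c i) ∧
      (∀ i j, i ≠ j → ∀ x, ∀ c ∈ Fr 𝒜 ⊤ (a i) x, ∀ d ∈ Fr 𝒜 ⊤ (a j) x,
        f i * c + f j * d = 0 → g i * c + g j * d = 0 → c = 0) ∧
      (∀ E : Ideal A, E ≤ J → (∀ (x : Proj 𝒜), ∀ q ∈ Fr 𝒜 I l x, α * q ∈ Fr 𝒜 E k x) →
        (∀ (x : Proj 𝒜), ∀ q ∈ Fr 𝒜 I l x, β * q ∈ Fr 𝒜 E k x) →
        ∀ x, Fr 𝒜 J k x ⊆ Fr 𝒜 E k x) := by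
  have hmono : Mono γ := hS.mono_f
  have hepi : Epi π := hS.epi_g
  obtain ⟨α, hα⟩ := exists_mul (biprod.inl ≫ π)
  obtain ⟨β, hβ⟩ := exists_mul (biprod.inr ≫ π)
  choose f hf using fun i => exists_mul (biproduct.ι (fun i => twist 𝒜 ⊤ (a i)) i ≫ γ ≫ biprod.fst)
  choose g hg using fun i => exists_mul (biproduct.ι (fun i => twist 𝒜 ⊤ (a i)) i ≫ γ ≫ biprod.snd)
  refine ⟨α, β, f, g, fun x q hq => mul_mem_Fr hα hq, fun x q hq => mul_mem_Fr hβ hq,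
    fun i x q hq => mul_mem_Fr (hf i) hq, fun i x q hq => mul_mem_Fr (hg i) hq, ?_, ?_, ?_,
    fun E hEJ hEα hEβ x => Fr_subset_of_epi π hα hβ hEJ hEα hEβ x⟩
  · rintro i x q ⟨m, j, p, d, hp, -, hd, hij, hdx, rfl⟩
    have hdx' : x ∈ Proj.basicOpen 𝒜 d := hdx
    obtain ⟨s, hs⟩ := exists_section_eq_div (I := ⊤) (Proj.basicOpen 𝒜 d) m j p d hp trivial hd
      hij le_rfl
    have hw := congrArg (fun z => evF (Scheme.Modules.Hom.app z (Proj.basicOpen 𝒜 d) s) x hdx')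
      (show (biproduct.ι _ i ≫ γ) ≫ π = 0 by rw [Category.assoc, w, comp_zero])
    dsimp only at hw
    rw [comp_app_apply, biprod_app_eq, evF_add, hα, hβ, ← comp_app_apply, ← comp_app_apply,
      Category.assoc, Category.assoc, hf, hg, hs] at hw
    exact hw.trans (evF_zero x hdx')
  · rintro x u ⟨m, j, p, d, hp, hpI, hd, hij, hdx, rfl⟩
      v ⟨m', j', p', d', hp', hpI', hd', hij', hdx', rfl⟩ h
    let U : (Proj 𝒜).Opens := Proj.basicOpen 𝒜 d ⊓ Proj.basicOpen 𝒜 d'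
    have hxU : x ∈ U := ⟨hdx, hdx'⟩
    obtain ⟨s, hs⟩ := exists_section_eq_div (I := I) U m j p d hp hpI hd hij inf_le_left
    obtain ⟨t, ht⟩ := exists_section_eq_div (I := I) U m' j' p' d' hp' hpI' hd' hij' inf_le_right
    obtain ⟨z, hz1, hz2⟩ := exists_biprod_section U s t
    obtain ⟨y, hy⟩ := exists_app_eq_of_shortExact hS U z (evF_ext fun y hy => by
      dsimp only
      rw [biprod_app_eq, evF_add, hα, hβ, hz1, hz2, hs, ht, h, evF_zero])
    dsimp only at hy
    refine ⟨fun i => evF ((biproduct.π (fun i => twist 𝒜 ⊤ (a i)) i).app U y) x hxU,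
      fun i => evF_mem_Fr _ _ _, ?_, ?_⟩
    · rw [← hs x hxU, ← hz1, ← hy, ← comp_app_apply, biproduct_app_eq, evF_sum]
      exact Finset.sum_congr rfl fun i _ => hf i _ _ _ _
    · rw [← ht x hxU, ← hz2, ← hy, ← comp_app_apply, biproduct_app_eq, evF_sum]
      exact Finset.sum_congr rfl fun i _ => hg i _ _ _ _
  · rintro i j hij x u ⟨m, e, p, d, hp, hpI, hd, he, hdx, rfl⟩
      v ⟨m', e', p', d', hp', hpI', hd', he', hdx', rfl⟩ h h'
    let U : (Proj 𝒜).Opens := Proj.basicOpen 𝒜 d ⊓ Proj.basicOpen 𝒜 d'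
    have hxU : x ∈ U := ⟨hdx, hdx'⟩
    obtain ⟨s, hs⟩ := exists_section_eq_div (I := ⊤) U m e p d hp trivial hd he inf_le_left
    obtain ⟨t, ht⟩ := exists_section_eq_div (I := ⊤) U m' e' p' d' hp' trivial hd' he' inf_le_right
    rw [← hs x hxU]
    rw [eq_zero_of_biproduct_mono γ U hij s t, evF_zero]
    apply biprod_section_ext
    · refine evF_ext fun y hy => ?_
      rw [map_add, map_zero, ← comp_app_apply, ← comp_app_apply, Category.assoc, Category.assoc,
        evF_add, hf, hf, hs, ht, h, evF_zero]
    · refine evF_ext fun y hy => ?_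
      rw [map_add, map_zero, ← comp_app_apply, ← comp_app_apply, Category.assoc, Category.assoc,
        evF_add, hg, hg, hs, ht, h', evF_zero]

end Extraction

/-! ### Homogeneous elements and ideals of the polynomial ring -/

section Polynomials

variable {K : Type u} [Field K] {r : ℕ}

theorem X_mem_grading (i : Fin (r + 1)) : (MvPolynomial.X i : CoordRing K r) ∈ grading K r 1 :=
  MvPolynomial.isHomogeneous_X K i

theorem X_pow_mem_grading (i : Fin (r + 1)) (n : ℕ) :
    (MvPolynomial.X i : CoordRing K r) ^ n ∈ grading K r n := by
  simpa using SetLike.pow_mem_graded n (X_mem_grading (K := K) i)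

theorem decompose_eq_homogeneousComponent (f : CoordRing K r) (n : ℕ) :
    (DirectSum.decompose (grading K r) f n : CoordRing K r) =
      MvPolynomial.homogeneousComponent n f :=
  MvPolynomial.decomposition.decompose'_apply f n

theorem X_mem_irrelevant (i : Fin (r + 1)) :
    (MvPolynomial.X i : CoordRing K r) ∈ HomogeneousIdeal.irrelevant (grading K r) := by
  rw [HomogeneousIdeal.mem_irrelevant_iff, GradedRing.proj_apply]
  exact DirectSum.decompose_of_mem_ne (grading K r) (X_mem_grading i) one_ne_zero

theorem irrelevant_le_of_X_mem {P : Ideal (CoordRing K r)}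
    (h : ∀ i, (MvPolynomial.X i : CoordRing K r) ∈ P) :
    (HomogeneousIdeal.irrelevant (grading K r)).toIdeal ≤ P := by
  intro f hf
  have h0 : MvPolynomial.coeff 0 f = 0 := by
    have h1 := (HomogeneousIdeal.mem_irrelevant_iff (grading K r) f).1 hf
    rwa [GradedRing.proj_apply, decompose_eq_homogeneousComponent,
      MvPolynomial.homogeneousComponent_zero, MvPolynomial.C_eq_zero] at h1
  have h2 : f ∈ Ideal.span (MvPolynomial.X '' (Set.univ : Set (Fin (r + 1)))) := by
    rw [MvPolynomial.mem_ideal_span_X_image]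
    intro m hm
    by_contra! hc
    have : m = 0 := by
      ext i
      exact hc i trivial
    rw [MvPolynomial.mem_support_iff, this] at hm
    exact hm h0
  refine Ideal.span_le.2 ?_ h2
  rintro _ ⟨i, -, rfl⟩
  exact h i

theorem exists_X_notMem (x : ProjSpace K r) :
    ∃ i, (MvPolynomial.X i : CoordRing K r) ∉ x.asHomogeneousIdeal := by
  by_contra! h
  exact x.not_irrelevant_le (irrelevant_le_of_X_mem h)

theorem X_not_all_dvd (hr : 1 ≤ r) {p : CoordRing K r} (hp : Prime p) :
    ∃ i, ¬ p ∣ (MvPolynomial.X i : CoordRing K r) := by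
  by_contra! h
  have h0 : Associated p (MvPolynomial.X (⟨0, by omega⟩ : Fin (r + 1))) :=
    hp.associated_of_dvd MvPolynomial.X_prime (h _)
  have h1 := h0.symm.dvd.trans (h (⟨1, by omega⟩ : Fin (r + 1)))
  rw [MvPolynomial.X_dvd_X] at h1
  simp at h1

/-- The point of `ℙ^r` given by a prime polynomial that generates a homogeneous ideal. -/
theorem exists_point_of_prime (hr : 1 ≤ r) {p : CoordRing K r} (hp : Prime p)
    (h : (Ideal.span {p}).IsHomogeneous (grading K r)) :
    ∃ x : ProjSpace K r, ∀ f, f ∈ x.asHomogeneousIdeal ↔ p ∣ f := by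
  refine ⟨(⟨⟨Ideal.span {p}, h⟩, (Ideal.span_singleton_prime hp.ne_zero).2 hp, fun hle => ?_⟩ :
    ProjectiveSpectrum (grading K r)), fun f => Ideal.mem_span_singleton⟩
  obtain ⟨i, hi⟩ := X_not_all_dvd hr hp
  exact hi (Ideal.mem_span_singleton.1 (hle (X_mem_irrelevant i)))

/-- A prime divisor of a nonzero homogeneous polynomial generates a homogeneous ideal: the
homogeneous core of that ideal is a nonzero prime inside a prime of height one. -/
theorem isHomogeneous_span_of_dvd {p f : CoordRing K r} (hp : Prime p) (hf : f ≠ 0) {n : ℕ}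
    (hfn : f ∈ grading K r n) (hpf : p ∣ f) : (Ideal.span {p}).IsHomogeneous (grading K r) := by
  have hP : (Ideal.span {p}).IsPrime := (Ideal.span_singleton_prime hp.ne_zero).2 hp
  have hQ := hP.homogeneousCore (𝒜 := grading K r)
  have hle := Ideal.toIdeal_homogeneousCore_le (grading K r) (Ideal.span {p})
  have hfQ : f ∈ ((Ideal.span {p}).homogeneousCore (grading K r)).toIdeal :=
    Ideal.mem_homogeneousCore_of_homogeneous_of_mem ⟨n, hfn⟩ (Ideal.mem_span_singleton.2 hpf)
  obtain ⟨q, hqQ, hq⟩ := hQ.exists_mem_prime_of_ne_bot fun h => hf (by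
    rw [h] at hfQ; exact hfQ)
  have hpq : p ∣ q := Ideal.mem_span_singleton.1 (hle hqQ)
  rw [Ideal.IsHomogeneous.iff_eq]
  refine le_antisymm hle ?_
  rw [Ideal.span_singleton_le_iff_mem]
  exact Ideal.mem_of_dvd _ (hp.associated_of_dvd hq hpq).symm.dvd hqQ

theorem mem_grading_of_mul {b c : CoordRing K r} {i j : ℕ} (hb : b ∈ grading K r j) (hb0 : b ≠ 0)
    (hbc : b * c ∈ grading K r i) {d : ℤ} (hij : (i : ℤ) = j + d) :
    c = 0 ∨ ∃ m : ℕ, d = m ∧ c ∈ grading K r m := by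
  classical
  have hcomp (n : ℕ) (hn : j + n ≠ i) :
      (DirectSum.decompose (grading K r) c n : CoordRing K r) = 0 := by
    have h1 := DirectSum.coe_decompose_mul_add_of_left_mem (grading K r) (b := c) (j := n) hb
    rw [DirectSum.decompose_of_mem_ne (grading K r) hbc (Ne.symm hn)] at h1
    exact (mul_eq_zero.1 h1.symm).resolve_left hb0
  rw [or_iff_not_imp_left]
  intro hc
  have : ∃ n, (DirectSum.decompose (grading K r) c n : CoordRing K r) ≠ 0 := by
    by_contra! h
    apply hc
    rw [← DirectSum.sum_support_decompose (grading K r) c]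
    exact Finset.sum_eq_zero fun n _ => h n
  obtain ⟨m, hm⟩ := this
  have hjm : j + m = i := by
    by_contra h
    exact hm (hcomp m h)
  refine ⟨m, by omega, ?_⟩
  have : c = (DirectSum.decompose (grading K r) c m : CoordRing K r) := by
    conv_lhs => rw [← DirectSum.sum_support_decompose (grading K r) c]
    rw [Finset.sum_eq_single m]
    · intro n _ hn
      exact hcomp n (by omega)
    · intro h
      simpa using h
  rw [this]
  exact SetLike.coe_mem _

theorem exists_homogeneous_notMem {I : Ideal (CoordRing K r)} (hI : I.IsHomogeneous (grading K r))
    {P : Ideal (CoordRing K r)} (h : ¬ I ≤ P) : ∃ (n : ℕ) (f : CoordRing K r),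
      f ∈ grading K r n ∧ f ∈ I ∧ f ∉ P := by
  classical
  by_contra! hc
  refine h fun f hf => ?_
  rw [← DirectSum.sum_support_decompose (grading K r) f]
  exact P.sum_mem fun n _ => hc n _ (SetLike.coe_mem _) (hI n hf)

/-- A homogeneous ideal that does not vanish at `x` contains the numerators of fractions of every
degree that are units at `x`. -/
theorem exists_unit_fraction {I : Ideal (CoordRing K r)} (hI : I.IsHomogeneous (grading K r))
    {x : ProjSpace K r} (h : ¬ I ≤ x.asHomogeneousIdeal.toIdeal) (d : ℤ) :
    ∃ (i j : ℕ) (f g : CoordRing K r), f ∈ grading K r i ∧ f ∈ I ∧ f ∉ x.asHomogeneousIdeal ∧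
      g ∈ grading K r j ∧ g ∉ x.asHomogeneousIdeal ∧ (i : ℤ) = j + d := by
  obtain ⟨n, f, hfn, hfI, hfx⟩ := exists_homogeneous_notMem hI h
  obtain ⟨l, hl⟩ := exists_X_notMem x
  have hpow (e : ℕ) : (MvPolynomial.X l : CoordRing K r) ^ e ∉ x.asHomogeneousIdeal :=
    fun h => hl ((ProjectiveSpectrum.isPrime x).mem_of_pow_mem _ h)
  refine ⟨n + d.natAbs, (n + d.natAbs - d).toNat, f * MvPolynomial.X l ^ d.natAbs,
    MvPolynomial.X l ^ _, SetLike.mul_mem_graded hfn (X_pow_mem_grading l _), I.mul_mem_right _ hfI,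
    fun h => ((ProjectiveSpectrum.isPrime x).mem_or_mem h).elim hfx (hpow _),
    X_pow_mem_grading l _, hpow _, by rw [Int.toNat_of_nonneg] <;> omega⟩

/-- Saturation: membership in a homogeneous ideal up to factors not vanishing at given points. -/
theorem exists_X_pow_mul_mem {E : Ideal (CoordRing K r)} {f : CoordRing K r}
    (h : ∀ x : ProjSpace K r, ∃ (n : ℕ) (s : CoordRing K r), s ∈ grading K r n ∧
      s ∉ x.asHomogeneousIdeal ∧ s * f ∈ E) (i : Fin (r + 1)) :
    ∃ M, MvPolynomial.X i ^ M * f ∈ E := by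
  let T : Ideal (CoordRing K r) := Submodule.comap (LinearMap.mulRight (CoordRing K r) f) E
  by_contra! hc
  have hX : (MvPolynomial.X i : CoordRing K r) ∉ T.radical := fun ⟨M, hM⟩ => hc M hM
  rw [Ideal.radical_eq_sInf, Submodule.mem_sInf] at hX
  push Not at hX
  obtain ⟨Q, ⟨hTQ, hQ⟩, hXQ⟩ := hX
  obtain ⟨n, s, hsn, hsx, hsE⟩ := h (⟨Ideal.homogeneousCore (grading K r) Q,
    Ideal.IsPrime.homogeneousCore hQ, fun hle =>
      hXQ (Ideal.toIdeal_homogeneousCore_le (grading K r) Q (hle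
      (X_mem_irrelevant i)))⟩ :
    ProjectiveSpectrum (grading K r))
  exact hsx (Ideal.mem_homogeneousCore_of_homogeneous_of_mem ⟨n, hsn⟩ (hTQ hsE))

end Polynomials

/-! ### Coprime polynomials and the saturation of the ideal they generate -/

section Coprime

variable {K : Type u} [Field K] {r : ℕ}

/-- Two coprime elements have only the Koszul syzygies. -/
theorem exists_koszul {R : Type*} [CommRing R] [IsDomain R] [UniqueFactorizationMonoid R]
    {a b u v : R} (hab : IsRelPrime a b) (h : a * u + b * v = 0) :
    ∃ w, u = b * w ∧ v = -(a * w) := by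
  have h1 : b ∣ u := by
    apply hab.symm.dvd_of_dvd_mul_left
    exact ⟨-v, by linear_combination h⟩
  obtain ⟨w, rfl⟩ := h1
  by_cases hb : b = 0
  · subst hb
    obtain ⟨c, hc⟩ := (isRelPrime_zero_right.1 hab).exists_right_inv
    exact ⟨-(c * v), by simp, by linear_combination (-v) * hc⟩
  · exact ⟨w, rfl, mul_left_cancel₀ hb (by linear_combination h)⟩

theorem ne_zero_or_ne_zero_of_isRelPrime {R : Type*} [CommRing R] [Nontrivial R] {a b : R}
    (hab : IsRelPrime a b) : a ≠ 0 ∨ b ≠ 0 := by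
  by_contra! h
  rw [h.1, h.2] at hab
  exact not_isUnit_zero (hab (dvd_zero 0) (dvd_zero 0))

/-- The powers of three distinct variables form a regular sequence. -/
theorem mem_span_X_pow_of_mul_mem {i j l : Fin (r + 1)} (hil : i ≠ l) (hjl : j ≠ l) (a b c : ℕ)
    {w : CoordRing K r}
    (h : MvPolynomial.X l ^ c * w ∈
      Ideal.span {(MvPolynomial.X i ^ a : CoordRing K r), MvPolynomial.X j ^ b}) :
    w ∈ Ideal.span {(MvPolynomial.X i ^ a : CoordRing K r), MvPolynomial.X j ^ b} := by
  have hset : ({(MvPolynomial.X i ^ a : CoordRing K r), MvPolynomial.X j ^ b} : Set _) =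
      (fun s => MvPolynomial.monomial s (1 : K)) ''
        {Finsupp.single i a, Finsupp.single j b} := by
    rw [Set.image_pair, MvPolynomial.X_pow_eq_monomial, MvPolynomial.X_pow_eq_monomial]
  rw [hset, MvPolynomial.mem_ideal_span_monomial_image] at h ⊢
  intro m hm
  obtain ⟨s, hs, hle⟩ := h (Finsupp.single l c + m) (by
    rw [MvPolynomial.mem_support_iff, MvPolynomial.X_pow_eq_monomial,
      MvPolynomial.coeff_monomial_mul, one_mul]
    exact MvPolynomial.mem_support_iff.1 hm)
  refine ⟨s, hs, ?_⟩
  have key (t : Fin (r + 1)) (e : ℕ) (ht : t ≠ l)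
      (hle : Finsupp.single t e ≤ Finsupp.single l c + m) :
      Finsupp.single t e ≤ m := by
    rw [Finsupp.single_le_iff] at hle ⊢
    simpa [Finsupp.single_eq_of_ne ht] using hle
  rcases hs with rfl | rfl
  · exact key i a hil hle
  · exact key j b hjl hle

theorem X_pow_dvd_of_mul_eq {i j : Fin (r + 1)} (hij : i ≠ j) (a b : ℕ) {u v : CoordRing K r}
    (h : MvPolynomial.X j ^ b * u = MvPolynomial.X i ^ a * v) :
    (MvPolynomial.X i ^ a : CoordRing K r) ∣ u := by
  refine MvPolynomial.X_prime.pow_dvd_of_dvd_mul_left a ?_ ⟨v, h⟩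
  intro hd
  have := MvPolynomial.X_prime.dvd_of_dvd_pow hd
  rw [MvPolynomial.X_dvd_X] at this
  exact hij this

/-- In at least three variables, the ideal generated by two coprime polynomials is saturated: the
irrelevant ideal has depth at least `3`. -/
theorem exists_eq_of_X_pow_mul (hr : 2 ≤ r) {a b f : CoordRing K r} (hab : IsRelPrime a b)
    (h : ∀ i, ∃ (M : ℕ) (u v : CoordRing K r), MvPolynomial.X i ^ M * f = a * u + b * v) :
    ∃ u v, f = a * u + b * v := by
  obtain ⟨M₀, u₀, v₀, h₀⟩ := h ⟨0, by omega⟩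
  obtain ⟨M₁, u₁, v₁, h₁⟩ := h ⟨1, by omega⟩
  obtain ⟨M₂, u₂, v₂, h₂⟩ := h ⟨2, by omega⟩
  have e01 : (⟨0, by omega⟩ : Fin (r + 1)) ≠ ⟨1, by omega⟩ := by simp
  have e02 : (⟨0, by omega⟩ : Fin (r + 1)) ≠ ⟨2, by omega⟩ := by simp
  have e12 : (⟨1, by omega⟩ : Fin (r + 1)) ≠ ⟨2, by omega⟩ := by simp
  have d01 := fun u v => X_pow_dvd_of_mul_eq (K := K) e01 M₀ M₁ (u := u) (v := v)
  have hreg := fun w => mem_span_X_pow_of_mul_mem (K := K) e02 e12 M₀ M₁ M₂ (w := w)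
  have hx0 : (MvPolynomial.X (⟨0, by omega⟩ : Fin (r + 1)) ^ M₀ : CoordRing K r) ≠ 0 :=
    pow_ne_zero _ (MvPolynomial.X_ne_zero _)
  generalize (MvPolynomial.X (⟨0, by omega⟩ : Fin (r + 1)) ^ M₀ : CoordRing K r) = x at *
  generalize (MvPolynomial.X (⟨1, by omega⟩ : Fin (r + 1)) ^ M₁ : CoordRing K r) = y at *
  generalize (MvPolynomial.X (⟨2, by omega⟩ : Fin (r + 1)) ^ M₂ : CoordRing K r) = z at *
  obtain ⟨w₀₁, hw, hw'⟩ := exists_koszul hab (u := y * u₀ - x * u₁) (v := y * v₀ - x * v₁)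
    (by linear_combination x * h₁ - y * h₀)
  obtain ⟨w₀₂, hp, hp'⟩ := exists_koszul hab (u := z * u₀ - x * u₂) (v := z * v₀ - x * v₂)
    (by linear_combination x * h₂ - z * h₀)
  obtain ⟨w₁₂, hq, hq'⟩ := exists_koszul hab (u := z * u₁ - y * u₂) (v := z * v₁ - y * v₂)
    (by linear_combination y * h₂ - z * h₁)
  have hcoc : z * w₀₁ = x * (-w₁₂) + y * w₀₂ := by
    rcases ne_zero_or_ne_zero_of_isRelPrime hab with h | h
    · exact mul_left_cancel₀ h (by linear_combination z * hw' - y * hp' + x * hq')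
    · exact mul_left_cancel₀ h (by linear_combination -z * hw + y * hp - x * hq)
  obtain ⟨t, s, hts⟩ := Ideal.mem_span_pair.1
    (hreg w₀₁ (Ideal.mem_span_pair.2 ⟨-w₁₂, w₀₂, by rw [hcoc]; ring⟩))
  obtain ⟨u, hu⟩ := d01 (u₀ - b * s) (u₁ + b * t) (by linear_combination hw - b * hts)
  obtain ⟨v, hv⟩ := d01 (v₀ + a * s) (v₁ - a * t) (by linear_combination hw' + a * hts)
  exact ⟨u, v, mul_left_cancel₀ hx0 (by linear_combination h₀ + a * hu + b * hv)⟩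

end Coprime

/-! ### Fractions and polynomials -/

section Fractions

/-- The embedding of the coordinate ring into its fraction field. -/
abbrev toFrac {K : Type u} [Field K] {r : ℕ} :
    CoordRing K r →+* FractionRing (CoordRing K r) :=
  algebraMap _ _

variable {K : Type u} [Field K] {r : ℕ} {I J : Ideal (CoordRing K r)} {k l : ℤ}

theorem top_not_le (x : ProjSpace K r) :
    ¬ (⊤ : Ideal (CoordRing K r)) ≤ x.asHomogeneousIdeal.toIdeal :=
  fun h => (ProjectiveSpectrum.isPrime x).ne_top (top_le_iff.1 h)

theorem div_eq_div_iff_mul {a b c d : CoordRing K r} (hb : b ≠ 0) (hd : d ≠ 0) :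
    toFrac a / toFrac b = toFrac c / toFrac d ↔ a * d = c * b := by
  rw [div_eq_div_iff (algebraMap_ne_zero hb) (algebraMap_ne_zero hd), ← map_mul, ← map_mul,
    (IsFractionRing.injective (CoordRing K r) (FractionRing (CoordRing K r))).eq_iff]

theorem zero_mem_Fr (I : Ideal (CoordRing K r)) (k : ℤ) (x : ProjSpace K r) :
    0 ∈ Fr (grading K r) I k x := by
  obtain ⟨i, j, f, g, -, -, -, hg, hgx, hij⟩ :=
    exists_unit_fraction (Ideal.IsHomogeneous.top _) (top_not_le x) k
  exact ⟨i, j, 0, g, zero_mem _, zero_mem _, hg, hij, hgx, by simp⟩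

theorem Fr_mono (h : I ≤ J) (x : ProjSpace K r) :
    Fr (grading K r) I k x ⊆ Fr (grading K r) J k x := by
  rintro q ⟨i, j, f, g, hf, hfI, hg, hij, hgx, rfl⟩
  exact ⟨i, j, f, g, hf, h hfI, hg, hij, hgx, rfl⟩

/-- If multiplication by `α` maps `I(k)` to `J(l)` near a point outside of the zero locus of `I`,
then `α` is a fraction of degree `l - k` at that point. -/
theorem mem_Fr_of_forall_mul_mem (hI : I.IsHomogeneous (grading K r)) {x : ProjSpace K r}
    (hx : ¬ I ≤ x.asHomogeneousIdeal.toIdeal) {α : FractionRing (CoordRing K r)}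
    (h : ∀ q ∈ Fr (grading K r) I k x, α * q ∈ Fr (grading K r) J l x) :
    α ∈ Fr (grading K r) ⊤ (l - k) x := by
  obtain ⟨i, j, f, g, hf, hfI, hfx, hg, hgx, hij⟩ := exists_unit_fraction hI hx k
  obtain ⟨i', j', f', g', hf', -, hg', hij', hgx', he⟩ :=
    h _ ⟨i, j, f, g, hf, hfI, hg, hij, hgx, rfl⟩
  refine ⟨i' + j, j' + i, f' * g, g' * f, SetLike.mul_mem_graded hf' hg, trivial,
    SetLike.mul_mem_graded hg' hf, by push_cast; omega, mul_notMem hgx' hfx, ?_⟩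
  have h1 := algebraMap_ne_zero (ne_zero_of_notMem hfx)
  have h2 := algebraMap_ne_zero (ne_zero_of_notMem hgx)
  have h3 := algebraMap_ne_zero (ne_zero_of_notMem hgx')
  rw [map_mul, map_mul]
  field_simp at he ⊢
  exact he

/-- A rational function without poles in codimension one is a polynomial. -/
theorem exists_polynomial_of_mem_Fr (hr : 1 ≤ r) {α : FractionRing (CoordRing K r)} {d : ℤ}
    (h : ∀ (x : ProjSpace K r) (p : CoordRing K r), Prime p →
      (∀ f, f ∈ x.asHomogeneousIdeal ↔ p ∣ f) → α ∈ Fr (grading K r) ⊤ d x) :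
    ∃ a, α = toFrac a ∧ (a = 0 ∨ ∃ m : ℕ, d = m ∧ a ∈ grading K r m) := by
  have hX0 : Prime (MvPolynomial.X 0 : CoordRing K r) := MvPolynomial.X_prime
  obtain ⟨x₀, hx₀⟩ := exists_point_of_prime hr hX0
    (isHomogeneous_span_of_dvd hX0 hX0.ne_zero (X_mem_grading 0) dvd_rfl)
  obtain ⟨i, j, f, g, hf, -, hg, hij, hgx, he⟩ := h x₀ _ hX0 hx₀
  have hg0 := ne_zero_of_notMem hgx
  obtain ⟨f', g', c, hfg, rfl, rfl⟩ := UniqueFactorizationMonoid.exists_reduced_factors' f g hg0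
  have hc0 : c ≠ 0 := left_ne_zero_of_mul hg0
  have hg0' : g' ≠ 0 := right_ne_zero_of_mul hg0
  have hu : IsUnit g' := by
    by_contra hu
    obtain ⟨p, hp, hpg⟩ := WfDvdMonoid.exists_irreducible_factor hu hg0'
    have hp : Prime p := hp.prime
    obtain ⟨x, hx⟩ := exists_point_of_prime hr hp
      (isHomogeneous_span_of_dvd hp hg0 hg (hpg.mul_left c))
    obtain ⟨i₁, j₁, f₁, g₁, -, -, -, -, hgx₁, he₁⟩ := h x p hp hx
    rw [he₁, div_eq_div_iff_mul (ne_zero_of_notMem hgx₁) hg0] at he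
    have h1 : f' * g₁ = f₁ * g' := mul_left_cancel₀ hc0 (by linear_combination -he)
    have h2 : p ∣ f' := (hp.dvd_or_dvd (h1 ▸ hpg.mul_left f₁)).resolve_right
      (fun h => hgx₁ ((hx _).2 h))
    exact hp.not_isUnit (hfg h2 hpg)
  obtain ⟨e, hge⟩ := hu.exists_right_inv
  refine ⟨f' * e, ?_, mem_grading_of_mul hg hg0 (i := i) ?_ hij⟩
  · rw [he, div_eq_iff (algebraMap_ne_zero hg0), ← map_mul]
    congr 1
    linear_combination (-c * f') * hge
  · convert hf using 1
    linear_combination (c * f') * hge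

end Fractions

/-! ### Ideals of the form `aI + bI` -/

section Core

variable {K : Type u} [Field K] {r : ℕ} {I J E : Ideal (CoordRing K r)} {k : ℤ}

theorem mem_of_local (hJ : ∀ f : CoordRing K r, (∀ i, ∃ M, MvPolynomial.X i ^ M * f ∈ J) → f ∈ J)
    {f : CoordRing K r}
    (h : ∀ x : ProjSpace K r, ∃ (n : ℕ) (s : CoordRing K r), s ∈ grading K r n ∧
      s ∉ x.asHomogeneousIdeal ∧ s * f ∈ J) : f ∈ J :=
  hJ f (exists_X_pow_mul_mem h)

/-- An inclusion of the stalks of two associated sheaves, in terms of the ideals. -/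
theorem exists_mul_mem_of_Fr_subset {x : ProjSpace K r}
    (h : Fr (grading K r) J k x ⊆ Fr (grading K r) E k x) {n : ℕ} {f : CoordRing K r}
    (hf : f ∈ grading K r n) (hfJ : f ∈ J) : ∃ (n : ℕ) (s : CoordRing K r), s ∈ grading K r n ∧
      s ∉ x.asHomogeneousIdeal ∧ s * f ∈ E := by
  obtain ⟨i, j, p, q, hp, -, hpx, hq, hqx, hij⟩ :=
    exists_unit_fraction (Ideal.IsHomogeneous.top _) (top_not_le x) (k - n)
  obtain ⟨i', j', h, e, -, hhE, he, -, hex, heq⟩ := @h (toFrac (f * p) / toFrac q)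
    ⟨n + i, j, f * p, q, SetLike.mul_mem_graded hf hp, J.mul_mem_right _ hfJ, hq,
      by push_cast; omega, hqx, rfl⟩
  rw [div_eq_div_iff_mul (ne_zero_of_notMem hqx) (ne_zero_of_notMem hex)] at heq
  refine ⟨i + j', p * e, SetLike.mul_mem_graded hp he, mul_notMem hpx hex, ?_⟩
  have : p * e * f = h * q := by rw [← heq]; ring
  rw [this]
  exact E.mul_mem_right _ hhE

/-- Multiplication by `a` maps `I` to the saturated ideal `J` if it does so on the associated
sheaves. -/
theorem mul_mem_of_forall_Fr (hI : I.IsHomogeneous (grading K r))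
    (hJ : ∀ f : CoordRing K r, (∀ i, ∃ M, MvPolynomial.X i ^ M * f ∈ J) → f ∈ J) {l : ℤ}
    {a : CoordRing K r}
    (h : ∀ x, ∀ q ∈ Fr (grading K r) I l x, toFrac a * q ∈ Fr (grading K r) J k x)
    {u : CoordRing K r} (hu : u ∈ I) : a * u ∈ J := by
  classical
  have hhom (n : ℕ) (u : CoordRing K r) (hn : u ∈ grading K r n) (hu : u ∈ I) : a * u ∈ J := by
    refine mem_of_local hJ fun x => ?_
    obtain ⟨i, j, p, q, hp, -, hpx, hq, hqx, hij⟩ :=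
      exists_unit_fraction (Ideal.IsHomogeneous.top _) (top_not_le x) (l - n)
    obtain ⟨i', j', h, e, -, hhE, he, -, hex, heq⟩ := h x (toFrac (u * p) / toFrac q)
      ⟨n + i, j, u * p, q, SetLike.mul_mem_graded hn hp, I.mul_mem_right _ hu, hq,
        by push_cast; omega, hqx, rfl⟩
    rw [← mul_div_assoc, ← map_mul,
      div_eq_div_iff_mul (ne_zero_of_notMem hqx) (ne_zero_of_notMem hex)] at heq
    refine ⟨i + j', p * e, SetLike.mul_mem_graded hp he, mul_notMem hpx hex, ?_⟩
    have : p * e * (a * u) = h * q := by rw [← heq]; ring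
    rw [this]
    exact J.mul_mem_right _ hhE
  rw [← DirectSum.sum_support_decompose (grading K r) u, Finset.mul_sum]
  exact J.sum_mem fun n _ => hhom n _ (SetLike.coe_mem _) (hI n hu)

theorem mul_mem_Fr_of_mem_grading {a : CoordRing K r}
    (ha : a = 0 ∨ ∃ m : ℕ, k = m ∧ a ∈ grading K r m) (haE : ∀ u ∈ I, a * u ∈ E)
    {x : ProjSpace K r} {l : ℤ} {q : FractionRing (CoordRing K r)}
    (hq : q ∈ Fr (grading K r) I l x) : toFrac a * q ∈ Fr (grading K r) E (k + l) x := by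
  rcases ha with rfl | ⟨m, rfl, ha⟩
  · rw [map_zero, zero_mul]
    exact zero_mem_Fr _ _ _
  · obtain ⟨i, j, f, g, hf, hfI, hg, hij, hgx, rfl⟩ := hq
    exact ⟨m + i, j, a * f, g, SetLike.mul_mem_graded ha hf, haE _ hfI, hg,
      by push_cast; omega, hgx, by rw [map_mul, mul_div_assoc]⟩

/-- The ideal `a I + b I`. -/
def combIdeal {R : Type*} [CommRing R] (I : Ideal R) (a b : R) : Ideal R :=
  Ideal.span {a} * I ⊔ Ideal.span {b} * I

theorem mem_combIdeal {R : Type*} [CommRing R] {I : Ideal R} {a b f : R} :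
    f ∈ combIdeal I a b ↔ ∃ u ∈ I, ∃ v ∈ I, f = a * u + b * v := by
  rw [combIdeal, Submodule.mem_sup]
  constructor
  · rintro ⟨y, hy, z, hz, rfl⟩
    obtain ⟨u, hu, rfl⟩ := Ideal.mem_span_singleton_mul.1 hy
    obtain ⟨v, hv, rfl⟩ := Ideal.mem_span_singleton_mul.1 hz
    exact ⟨u, hu, v, hv, rfl⟩
  · rintro ⟨u, hu, v, hv, rfl⟩
    exact ⟨_, Ideal.mem_span_singleton_mul.2 ⟨u, hu, rfl⟩, _,
      Ideal.mem_span_singleton_mul.2 ⟨v, hv, rfl⟩, rfl⟩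

/-- `a I + b I` is saturated, if `I` is and contains the coprime elements `a` and `b`. -/
theorem mem_combIdeal_of_X_pow_mul (hr : 2 ≤ r) {a b f : CoordRing K r}
    (hI : ∀ f : CoordRing K r, (∀ i, ∃ M, MvPolynomial.X i ^ M * f ∈ I) → f ∈ I)
    (hab : IsRelPrime a b) (ha : a ∈ I) (hb : b ∈ I)
    (h : ∀ i, ∃ M, MvPolynomial.X i ^ M * f ∈ combIdeal I a b) : f ∈ combIdeal I a b := by
  obtain ⟨u, v, rfl⟩ := exists_eq_of_X_pow_mul hr hab (f := f) fun i => by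
    obtain ⟨M, hM⟩ := h i
    obtain ⟨u, -, v, -, e⟩ := mem_combIdeal.1 hM
    exact ⟨M, u, v, e⟩
  refine mem_combIdeal.2 ⟨u, hI u fun i => ?_, v, hI v fun i => ?_, rfl⟩ <;>
  · obtain ⟨M, hM⟩ := h i
    obtain ⟨u', hu', v', hv', e⟩ := mem_combIdeal.1 hM
    obtain ⟨w, hw, hw'⟩ := exists_koszul hab (u := MvPolynomial.X i ^ M * u - u')
      (v := MvPolynomial.X i ^ M * v - v') (by linear_combination e)
    refine ⟨M, ?_⟩
    first
    | rw [sub_eq_iff_eq_add.1 hw]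
      exact I.add_mem (I.mul_mem_right _ hb) hu'
    | rw [sub_eq_iff_eq_add.1 hw']
      exact I.add_mem (I.neg_mem (I.mul_mem_right _ ha)) hv'

/-- If `a I + b I` agrees locally with an ideal `J` whose zero locus contains no hypersurface, then
`a` and `b` are coprime: `J` vanishes on the zero locus of a common prime factor. -/
theorem isRelPrime_of_forall_exists_mul_mem (hr : 1 ≤ r) (hJ : J.IsHomogeneous (grading K r))
    (hJp : ∀ (x : ProjSpace K r) (p : CoordRing K r), Prime p →
      (∀ f, f ∈ x.asHomogeneousIdeal ↔ p ∣ f) → ¬ J ≤ x.asHomogeneousIdeal.toIdeal)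
    {a b : CoordRing K r} (ha : a = 0 ∨ ∃ m : ℕ, k = m ∧ a ∈ grading K r m)
    (hb : b = 0 ∨ ∃ m : ℕ, k = m ∧ b ∈ grading K r m)
    (h : ∀ (x : ProjSpace K r) (n : ℕ), ∀ f ∈ grading K r n, f ∈ J →
      ∃ (n : ℕ) (s : CoordRing K r), s ∈ grading K r n ∧
      s ∉ x.asHomogeneousIdeal ∧ s * f ∈ combIdeal I a b) : IsRelPrime a b := by
  have key (p : CoordRing K r) (hp : Prime p)
      (hhom : (Ideal.span {p}).IsHomogeneous (grading K r)) : ¬ (p ∣ a ∧ p ∣ b) := by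
    rintro ⟨hpa, hpb⟩
    obtain ⟨x, hx⟩ := exists_point_of_prime hr hp hhom
    obtain ⟨n, f, hfn, hfJ, hfx⟩ := exists_homogeneous_notMem hJ (hJp x p hp hx)
    obtain ⟨n', s, -, hsx, hsf⟩ := h x n f hfn hfJ
    obtain ⟨u, -, v, -, e⟩ := mem_combIdeal.1 hsf
    refine mul_notMem hsx hfx ?_
    rw [hx, e]
    exact dvd_add (hpa.mul_right u) (hpb.mul_right v)
  have hX0 : Prime (MvPolynomial.X 0 : CoordRing K r) := MvPolynomial.X_prime
  have hne : a ≠ 0 ∨ b ≠ 0 := by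
    by_contra! hc
    refine key _ hX0 (isHomogeneous_span_of_dvd hX0 hX0.ne_zero (X_mem_grading 0) dvd_rfl) ?_
    rw [hc.1, hc.2]
    exact ⟨dvd_zero _, dvd_zero _⟩
  intro d hda hdb
  by_contra hu
  have hd : d ≠ 0 := by
    rintro rfl
    rw [zero_dvd_iff] at hda hdb
    exact hne.elim (· hda) (· hdb)
  obtain ⟨p, hp, hpd⟩ := WfDvdMonoid.exists_irreducible_factor hu hd
  refine key p hp.prime ?_ ⟨hpd.trans hda, hpd.trans hdb⟩
  rcases hne with h | h
  · obtain ⟨m, -, hm⟩ := ha.resolve_left h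
    exact isHomogeneous_span_of_dvd hp.prime h hm (hpd.trans hda)
  · obtain ⟨m, -, hm⟩ := hb.resolve_left h
    exact isHomogeneous_span_of_dvd hp.prime h hm (hpd.trans hdb)

/-- If the kernel of `(α, β)` on `I ⊕ I` is locally free on the columns `(f i, g i)`, then `α` and
`β` lie in `I`: the columns are multiples `w i • (β, -α)` of the Koszul syzygy, the kernel has rank
one, so that there is a single column, and its factor `w i` is a unit because the Koszul syzygy lies
in the kernel outside of the zero locus of `I`, which contains no hypersurface. -/
theorem mem_of_syzygies (hr : 1 ≤ r) (hI : I.IsHomogeneous (grading K r))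
    (hIs : ∀ f : CoordRing K r, (∀ i, ∃ M, MvPolynomial.X i ^ M * f ∈ I) → f ∈ I)
    (hIp : ∀ (x : ProjSpace K r) (p : CoordRing K r), Prime p →
      (∀ f, f ∈ x.asHomogeneousIdeal ↔ p ∣ f) → ¬ I ≤ x.asHomogeneousIdeal.toIdeal)
    {m : ℕ} {α β : CoordRing K r} (hα : α ∈ grading K r m) (hβ : β ∈ grading K r m)
    (hαβ : IsRelPrime α β)
    {n : ℕ} {a : Fin n → ℤ} {f g : Fin n → FractionRing (CoordRing K r)}
    (hf : ∀ i x, ∀ q ∈ Fr (grading K r) ⊤ (a i) x, f i * q ∈ Fr (grading K r) I 0 x)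
    (hg : ∀ i x, ∀ q ∈ Fr (grading K r) ⊤ (a i) x, g i * q ∈ Fr (grading K r) I 0 x)
    (hsyz : ∀ i x, ∀ q ∈ Fr (grading K r) ⊤ (a i) x,
      toFrac α * (f i * q) + toFrac β * (g i * q) = 0)
    (hexact : ∀ x, ∀ u ∈ Fr (grading K r) I 0 x, ∀ v ∈ Fr (grading K r) I 0 x,
      toFrac α * u + toFrac β * v = 0 → ∃ c : Fin n → FractionRing (CoordRing K r),
        (∀ i, c i ∈ Fr (grading K r) ⊤ (a i) x) ∧ u = ∑ i, f i * c i ∧ v = ∑ i, g i * c i)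
    (hinj : ∀ i j, i ≠ j → ∀ x, ∀ c ∈ Fr (grading K r) ⊤ (a i) x,
      ∀ d ∈ Fr (grading K r) ⊤ (a j) x,
        f i * c + f j * d = 0 → g i * c + g j * d = 0 → c = 0) :
    α ∈ I ∧ β ∈ I := by
  have hne := ne_zero_or_ne_zero_of_isRelPrime hαβ
  have hinj_frac := IsFractionRing.injective (CoordRing K r) (FractionRing (CoordRing K r))
  have hX0 : Prime (MvPolynomial.X 0 : CoordRing K r) := MvPolynomial.X_prime
  obtain ⟨x₀, hx₀⟩ := exists_point_of_prime hr hX0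
    (isHomogeneous_span_of_dvd hX0 hX0.ne_zero (X_mem_grading 0) dvd_rfl)
  have hpoly (f : FractionRing (CoordRing K r)) (d : ℤ)
      (hf : ∀ x, ∀ q ∈ Fr (grading K r) ⊤ d x, f * q ∈ Fr (grading K r) I 0 x) :
      ∃ p, f = toFrac p ∧ (p = 0 ∨ ∃ m : ℕ, 0 - d = m ∧ p ∈ grading K r m) :=
    exists_polynomial_of_mem_Fr hr fun x p hp hx =>
      mem_Fr_of_forall_mul_mem (Ideal.IsHomogeneous.top _) (top_not_le x)
        fun q hq => Fr_mono le_top x (hf x q hq)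
  choose f' hf' hfd using fun i => hpoly (f i) (a i) (hf i)
  choose g' hg' hgd using fun i => hpoly (g i) (a i) (hg i)
  -- The columns are multiples of the Koszul syzygy.
  have hw (i : Fin n) : ∃ w, f' i = β * w ∧ g' i = -(α * w) := by
    refine exists_koszul hαβ ?_
    obtain ⟨e, e', p, q, hp, -, hpx, hq, hqx, hij⟩ :=
      exists_unit_fraction (Ideal.IsHomogeneous.top _) (top_not_le x₀) (a i)
    have h := hsyz i x₀ _ ⟨e, e', p, q, hp, trivial, hq, hij, hqx, rfl⟩
    have h1 : toFrac p / toFrac q ≠ 0 := div_ne_zero (algebraMap_ne_zero (ne_zero_of_notMem hpx))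
      (algebraMap_ne_zero (ne_zero_of_notMem hqx))
    rw [← mul_assoc, ← mul_assoc, ← add_mul, hf', hg', ← map_mul, ← map_mul, ← map_add] at h
    exact (map_eq_zero_iff _ hinj_frac).1 ((mul_eq_zero.1 h).resolve_right h1)
  choose w hfw hgw using hw
  have hwd (i : Fin n) : w i = 0 ∨ ∃ e : ℕ, -a i - m = e ∧ w i ∈ grading K r e := by
    by_cases hwi : w i = 0
    · exact Or.inl hwi
    rcases hne with h | h
    · obtain ⟨e, he, hge⟩ := (hgd i).resolve_left (by
        rw [hgw, neg_eq_zero]; exact mul_ne_zero h hwi)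
      refine mem_grading_of_mul hα h (i := e) ?_ (by omega)
      have := neg_mem hge
      rwa [hgw, neg_neg] at this
    · obtain ⟨e, he, hfe⟩ := (hfd i).resolve_left (by
        rw [hfw]; exact mul_ne_zero h hwi)
      refine mem_grading_of_mul hβ h (i := e) ?_ (by omega)
      rwa [hfw] at hfe
  -- Outside of the zero locus of `I` the Koszul syzygy is a combination of the columns.
  have hunit (x : ProjSpace K r) (hx : ¬ I ≤ x.asHomogeneousIdeal.toIdeal) :
      ∃ p q, p ∉ x.asHomogeneousIdeal ∧ q ∉ x.asHomogeneousIdeal ∧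
        ∃ c : Fin n → FractionRing (CoordRing K r),
          (∀ i, c i ∈ Fr (grading K r) ⊤ (a i) x) ∧
            toFrac p / toFrac q = ∑ i, toFrac (w i) * c i := by
    obtain ⟨i, j, p, q, hp, hpI, hpx, hq, hqx, hij⟩ := exists_unit_fraction hI hx (-m)
    obtain ⟨c, hc, hu, hv⟩ := hexact x (toFrac (β * p) / toFrac q)
      ⟨m + i, j, β * p, q, SetLike.mul_mem_graded hβ hp, I.mul_mem_left _ hpI, hq,
        by push_cast; omega, hqx, rfl⟩ (toFrac (-(α * p)) / toFrac q)
      ⟨m + i, j, -(α * p), q, neg_mem (SetLike.mul_mem_graded hα hp),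
        I.neg_mem (I.mul_mem_left _ hpI), hq, by push_cast; omega, hqx, rfl⟩
      (by simp only [map_mul, map_neg]; ring)
    refine ⟨p, q, hpx, hqx, c, hc, ?_⟩
    rcases hne with h | h
    · apply mul_left_cancel₀ (algebraMap_ne_zero h)
      rw [Finset.mul_sum, ← neg_inj, ← Finset.sum_neg_distrib]
      convert hv using 1
      · simp only [map_mul, map_neg]; ring
      · refine Finset.sum_congr rfl fun i _ => ?_
        rw [hg', hgw]
        simp only [map_mul, map_neg]; ring
    · apply mul_left_cancel₀ (algebraMap_ne_zero h)
      rw [Finset.mul_sum]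
      convert hu using 1
      · simp only [map_mul]; ring
      · refine Finset.sum_congr rfl fun i _ => ?_
        rw [hf', hfw]
        simp only [map_mul]; ring
  obtain ⟨i₀, hi₀⟩ : ∃ i₀, w i₀ ≠ 0 := by
    by_contra! h
    obtain ⟨p, q, hp, hq, c, -, e⟩ := hunit x₀ (hIp x₀ _ hX0 hx₀)
    rw [Finset.sum_eq_zero fun i _ => by rw [h, map_zero, zero_mul]] at e
    exact div_ne_zero (algebraMap_ne_zero (ne_zero_of_notMem hp))
      (algebraMap_ne_zero (ne_zero_of_notMem hq)) e
  obtain ⟨e₀, he₀, hwe₀⟩ := (hwd i₀).resolve_left hi₀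
  -- Two columns would be linearly dependent.
  have huniq (i : Fin n) : i = i₀ := by
    by_contra hi
    obtain ⟨j, j', p, q, hp, -, hpx, hq, hqx, hij⟩ :=
      exists_unit_fraction (Ideal.IsHomogeneous.top _) (top_not_le x₀) (a i + a i₀ + m)
    have h := hinj i i₀ hi x₀ (toFrac (w i₀ * p) / toFrac q)
      ⟨e₀ + j, j', w i₀ * p, q, SetLike.mul_mem_graded hwe₀ hp, trivial, hq,
        by push_cast; omega, hqx, rfl⟩ (toFrac (-(w i * p)) / toFrac q) (by
        rcases hwd i with h | ⟨e, he, hwe⟩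
        · rw [h, zero_mul, neg_zero, map_zero, zero_div]
          exact zero_mem_Fr _ _ _
        · exact ⟨e + j, j', -(w i * p), q, neg_mem (SetLike.mul_mem_graded hwe hp), trivial, hq,
            by push_cast; omega, hqx, rfl⟩)
      (by rw [hf', hf', hfw, hfw]; simp only [map_mul, map_neg]; ring)
      (by rw [hg', hg', hgw, hgw]; simp only [map_mul, map_neg]; ring)
    exact div_ne_zero (algebraMap_ne_zero (mul_ne_zero hi₀ (ne_zero_of_notMem hpx)))
      (algebraMap_ne_zero (ne_zero_of_notMem hqx)) h
  -- The factor of the remaining column vanishes on no hypersurface.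
  have hwu : IsUnit (w i₀) := by
    by_contra hu
    obtain ⟨p, hp, hpw⟩ := WfDvdMonoid.exists_irreducible_factor hu hi₀
    obtain ⟨x, hx⟩ := exists_point_of_prime hr hp.prime
      (isHomogeneous_span_of_dvd hp.prime hi₀ hwe₀ hpw)
    obtain ⟨s, t, hs, ht, c, hc, e⟩ := hunit x (hIp x p hp.prime hx)
    rw [Finset.sum_eq_single i₀ (fun i _ h => absurd (huniq i) h)
      (fun h => absurd (Finset.mem_univ _) h)] at e
    obtain ⟨-, -, c₁, c₂, -, -, -, -, hc₂, hce⟩ := hc i₀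
    rw [hce, ← mul_div_assoc, ← map_mul,
      div_eq_div_iff_mul (ne_zero_of_notMem ht) (ne_zero_of_notMem hc₂)] at e
    refine mul_notMem hs hc₂ ?_
    rw [hx, e]
    exact (hpw.mul_right c₁).mul_right t
  obtain ⟨w', hw'⟩ := hwu.exists_right_inv
  constructor
  · have : g' i₀ * 1 ∈ I := mul_mem_of_forall_Fr (k := 0) (Ideal.IsHomogeneous.top _) hIs
      (fun x q hq => by rw [← hg']; exact hg i₀ x q hq) Submodule.mem_top
    rw [hgw, mul_one] at this
    have h2 := I.mul_mem_right w' (I.neg_mem this)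
    rwa [neg_neg, mul_assoc, hw', mul_one] at h2
  · have : f' i₀ * 1 ∈ I := mul_mem_of_forall_Fr (k := 0) (Ideal.IsHomogeneous.top _) hIs
      (fun x q hq => by rw [← hf']; exact hf i₀ x q hq) Submodule.mem_top
    rw [hfw, mul_one] at this
    have h2 := I.mul_mem_right w' this
    rwa [mul_assoc, hw', mul_one] at h2

/-- Let `I` and `J` be saturated homogeneous ideals whose zero loci contain no hypersurface. If
there is a short exact sequence `0 ⟶ ⨁ 𝒪(a i) ⟶ I(0) ⊞ I(0) ⟶ J(k) ⟶ 0` of the associated sheaves,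
then `J = α I + β I` for two coprime forms `α, β ∈ I` of the same degree. -/
theorem exists_eq_combIdeal (hr : 2 ≤ r) (hI : I.IsHomogeneous (grading K r))
    (hIs : ∀ f : CoordRing K r, (∀ i, ∃ M, MvPolynomial.X i ^ M * f ∈ I) → f ∈ I)
    (hIp : ∀ (x : ProjSpace K r) (p : CoordRing K r), Prime p →
      (∀ f, f ∈ x.asHomogeneousIdeal ↔ p ∣ f) → ¬ I ≤ x.asHomogeneousIdeal.toIdeal)
    (hJ : J.IsHomogeneous (grading K r))
    (hJs : ∀ f : CoordRing K r, (∀ i, ∃ M, MvPolynomial.X i ^ M * f ∈ J) → f ∈ J)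
    (hJp : ∀ (x : ProjSpace K r) (p : CoordRing K r), Prime p →
      (∀ f, f ∈ x.asHomogeneousIdeal ↔ p ∣ f) → ¬ J ≤ x.asHomogeneousIdeal.toIdeal)
    {n : ℕ} {a : Fin n → ℤ}
    (γ : (⨁ fun i => twist (grading K r) ⊤ (a i)) ⟶
      twist (grading K r) I 0 ⊞ twist (grading K r) I 0)
    (π : twist (grading K r) I 0 ⊞ twist (grading K r) I 0 ⟶ twist (grading K r) J k)
    (w : γ ≫ π = 0) (hS : (ShortComplex.mk γ π w).ShortExact) :
    ∃ (m : ℕ) (α β : CoordRing K r), α ∈ grading K r m ∧ β ∈ grading K r m ∧ α ∈ I ∧ β ∈ I ∧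
      IsRelPrime α β ∧ J = combIdeal I α β := by
  classical
  have hr1 : 1 ≤ r := by omega
  obtain ⟨α, β, f, g, hα, hβ, hf, hg, hsyz, hexact, hinj, hsurj⟩ := exists_matrices γ π w hS
  have hpoly (α : FractionRing (CoordRing K r))
      (hα : ∀ x, ∀ q ∈ Fr (grading K r) I 0 x, α * q ∈ Fr (grading K r) J k x) :
      ∃ p, α = toFrac p ∧ (p = 0 ∨ ∃ m : ℕ, k = m ∧ p ∈ grading K r m) :=
    exists_polynomial_of_mem_Fr hr1 fun x p hp hx => by
      have := mem_Fr_of_forall_mul_mem hI (hIp x p hp hx) (hα x)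
      rw [sub_zero] at this
      exact Fr_mono le_top x this
  obtain ⟨α, rfl, hαd⟩ := hpoly α hα
  obtain ⟨β, rfl, hβd⟩ := hpoly β hβ
  have hle : combIdeal I α β ≤ J := by
    intro z hz
    obtain ⟨u, hu, v, hv, rfl⟩ := mem_combIdeal.1 hz
    exact J.add_mem (mul_mem_of_forall_Fr hI hJs hα hu) (mul_mem_of_forall_Fr hI hJs hβ hv)
  have hsub := hsurj (combIdeal I α β) hle
    (fun x q hq => by
      have := mul_mem_Fr_of_mem_grading (E := combIdeal I α β) hαd
        (fun u hu => mem_combIdeal.2 ⟨u, hu, 0, zero_mem _, by ring⟩) hq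
      rwa [add_zero] at this)
    (fun x q hq => by
      have := mul_mem_Fr_of_mem_grading (E := combIdeal I α β) hβd
        (fun u hu => mem_combIdeal.2 ⟨0, zero_mem _, u, hu, by ring⟩) hq
      rwa [add_zero] at this)
  have hrel : IsRelPrime α β := isRelPrime_of_forall_exists_mul_mem hr1 hJ hJp hαd hβd
    fun x n f hf hfJ => exists_mul_mem_of_Fr_subset (hsub x) hf hfJ
  obtain ⟨m, hkm⟩ : ∃ m : ℕ, k = m := by
    rcases ne_zero_or_ne_zero_of_isRelPrime hrel with h | h
    · obtain ⟨m, hm, -⟩ := hαd.resolve_left h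
      exact ⟨m, hm⟩
    · obtain ⟨m, hm, -⟩ := hβd.resolve_left h
      exact ⟨m, hm⟩
  have hdeg (p : CoordRing K r) (hp : p = 0 ∨ ∃ m : ℕ, k = m ∧ p ∈ grading K r m) :
      p ∈ grading K r m := by
    rcases hp with rfl | ⟨m', h, hp⟩
    · exact zero_mem _
    · rwa [show m = m' by omega]
  obtain ⟨hαI, hβI⟩ := mem_of_syzygies hr1 hI hIs hIp (hdeg α hαd) (hdeg β hβd) hrel hf hg hsyz
    hexact hinj
  refine ⟨m, α, β, hdeg α hαd, hdeg β hβd, hαI, hβI, hrel, le_antisymm (fun z hz => ?_) hle⟩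
  rw [← DirectSum.sum_support_decompose (grading K r) z]
  refine sum_mem fun n _ => mem_combIdeal_of_X_pow_mul hr hIs hrel hαI hβI fun i => ?_
  exact exists_X_pow_mul_mem
    (fun x => exists_mul_mem_of_Fr_subset (hsub x) (SetLike.coe_mem _) (hJ n hz)) i

end Core

/-! ### Regular functions as elements of the fraction field -/

section Functions

variable {A σ : Type u} [CommRing A] [IsDomain A] [SetLike σ A] [AddSubgroupClass σ A]
variable {𝒜 : ℕ → σ} [GradedRing 𝒜]

/-- The embedding of the stalk of the structure sheaf of `Proj A` at `x` into the fraction field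
of `A`. -/
def sheafStalkToF (x : ProjectiveSpectrum.top 𝒜) :
    (ProjectiveSpectrum.Proj.structureSheaf 𝒜).presheaf.stalk x →+* FractionRing A where
  toFun z := toF x (HomogeneousLocalization.val (Proj.stalkIso' 𝒜 x z))
  map_one' := by rw [map_one, HomogeneousLocalization.val_one, map_one]
  map_mul' a b := by rw [map_mul, HomogeneousLocalization.val_mul, map_mul]
  map_zero' := by rw [map_zero, HomogeneousLocalization.val_zero, map_zero]
  map_add' a b := by rw [map_add, HomogeneousLocalization.val_add, map_add]

/-- The embedding of the local ring of the scheme `Proj A` at `x` into the fraction field of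
`A`. -/
def stalkToF (x : Proj 𝒜) : (Proj 𝒜).presheaf.stalk x →+* FractionRing A :=
  sheafStalkToF x

theorem stalkToF_injective (x : Proj 𝒜) : Function.Injective (stalkToF x) :=
  (toF_injective x).comp ((HomogeneousLocalization.val_injective _).comp
    (Proj.stalkIso' 𝒜 x).injective)

theorem stalkToF_germ {U : (Proj 𝒜).Opens} (t : Γ(Proj 𝒜, U)) (x : Proj 𝒜) (hx : x ∈ U) :
    stalkToF x ((Proj 𝒜).presheaf.germ U x hx t) = evOF t x hx :=
  congrArg (fun z => toF x (HomogeneousLocalization.val z)) (Proj.stalkIso'_germ 𝒜 U x hx t)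

theorem evOF_map {U V : (Proj 𝒜).Opens} (i : V ⟶ U) (s : Γ(Proj 𝒜, U)) (x : Proj 𝒜)
    (hx : x ∈ V) : evOF ((Proj 𝒜).presheaf.map i.op s) x hx = evOF s x (i.le hx) := rfl

/-- The value of regular functions at `x`, as a ring homomorphism to the fraction field. -/
def evOFHom (U : (Proj 𝒜).Opens) (x : Proj 𝒜) (hx : x ∈ U) : Γ(Proj 𝒜, U) →+* FractionRing A :=
  (stalkToF x).comp ((Proj 𝒜).presheaf.germ U x hx).hom

theorem evOFHom_apply (U : (Proj 𝒜).Opens) (x : Proj 𝒜) (hx : x ∈ U) (t : Γ(Proj 𝒜, U)) :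
    evOFHom U x hx t = evOF t x hx := stalkToF_germ t x hx

theorem evOF_frac {U : (Proj 𝒜).Opens} (s : Γ(Proj 𝒜, U)) (x : Proj 𝒜) (hx : x ∈ U) :
    ∃ (i : ℕ) (f g : A), f ∈ 𝒜 i ∧ g ∈ 𝒜 i ∧
      ∃ V : (Proj 𝒜).Opens, x ∈ V ∧ V ≤ U ∧ V ≤ Proj.basicOpen 𝒜 g ∧
        ∀ (y : Proj 𝒜) (_ : y ∈ V) (hU : y ∈ U), evOF s y hU =
          algebraMap A (FractionRing A) f / algebraMap A (FractionRing A) g := by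
  obtain ⟨V, hxV, i, n, ⟨f, hf⟩, ⟨g, hg⟩, hV, h⟩ := Subtype.prop
    (p := fun s => s ∈ ProjectiveSpectrum.StructureSheaf.sectionsSubring (𝒜 := 𝒜) (op U)) s ⟨x, hx⟩
  refine ⟨n, f, g, hf, hg, V, hxV, i.le, fun y hy => hV ⟨y, hy⟩, fun y hy hU => ?_⟩
  exact (congrArg (fun z => toF y (HomogeneousLocalization.val z)) (h ⟨y, hy⟩)).trans
    ((congrArg (toF y) (HomogeneousLocalization.val_mk _)).trans (toF_mk _ _ _))

theorem evOF_eq_genPt {U : (Proj 𝒜).Opens} (s : Γ(Proj 𝒜, U)) (z x : Proj 𝒜) (hx : x ∈ U) :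
    evOF s x hx = evOF s (genPt z) (genPt_mem z hx) := by
  obtain ⟨i, f, g, hf, hg, V, hxV, hVU, hVg, h⟩ := evOF_frac s x hx
  rw [h x hxV hx, h _ (genPt_mem z hxV)]

/-- As `Proj A` is integral, a regular function is determined by its germ at one point. -/
theorem eq_of_evOF_eq {U : (Proj 𝒜).Opens} {s t : Γ(Proj 𝒜, U)} (x : Proj 𝒜) (hx : x ∈ U)
    (h : evOF s x hx = evOF t x hx) : s = t := by
  have h' (y : Proj 𝒜) (hy : y ∈ U) : evOF s y hy = evOF t y hy := by
    rw [evOF_eq_genPt s x, evOF_eq_genPt t x, ← evOF_eq_genPt s x x hx,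
      ← evOF_eq_genPt t x x hx, h]
  exact Subtype.ext (funext fun y =>
    HomogeneousLocalization.val_injective _ (toF_injective y.1 (h' y.1 y.2)))

theorem evOF_awayToSection {f : A} {d : ℕ} (hf : f ∈ 𝒜 d) (n : ℕ) (a : A) (ha : a ∈ 𝒜 (n • d))
    (x : Proj 𝒜) (hx : x ∈ Proj.basicOpen 𝒜 f) :
    evOF ((Proj.awayToSection 𝒜 f).hom (HomogeneousLocalization.Away.mk 𝒜 hf n a ha)) x hx =
      algebraMap A (FractionRing A) a / algebraMap A (FractionRing A) (f ^ n) :=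
  (congrArg (toF x) (HomogeneousLocalization.val_mk _)).trans (toF_mk _ _ _)

theorem add_mem_Fr {I : Ideal A} {k : ℤ} {x : Proj 𝒜} {p q : FractionRing A}
    (hp : p ∈ Fr 𝒜 I k x) (hq : q ∈ Fr 𝒜 I k x) : p + q ∈ Fr 𝒜 I k x := by
  obtain ⟨i, j, f, g, hf, hfI, hg, hij, hgx, rfl⟩ := hp
  obtain ⟨i', j', f', g', hf', hfI', hg', hij', hgx', rfl⟩ := hq
  refine ⟨i + j', j + j', f * g' + g * f', g * g',
    add_mem (SetLike.mul_mem_graded hf hg') ?_,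
    add_mem (I.mul_mem_right _ hfI) (I.mul_mem_left _ hfI'), SetLike.mul_mem_graded hg hg',
    by push_cast; omega, fun h => ((ProjectiveSpectrum.isPrime x).mem_or_mem h).elim hgx hgx', ?_⟩
  · have : i + j' = j + i' := by omega
    rw [this]
    exact SetLike.mul_mem_graded hg hf'
  · have h1 : g ≠ 0 := fun h => hgx (h ▸ zero_mem _)
    have h2 : g' ≠ 0 := fun h => hgx' (h ▸ zero_mem _)
    rw [div_add_div _ _ (algebraMap_ne_zero h1) (algebraMap_ne_zero h2)]
    simp only [map_add, map_mul]

theorem mul_mem_Fr_of_mem_of_mem {I : Ideal A} {k l : ℤ} {x : Proj 𝒜} {p q : FractionRing A}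
    (hp : p ∈ Fr 𝒜 ⊤ k x) (hq : q ∈ Fr 𝒜 I l x) : p * q ∈ Fr 𝒜 I (k + l) x := by
  obtain ⟨i, j, f, g, hf, -, hg, hij, hgx, rfl⟩ := hp
  obtain ⟨i', j', f', g', hf', hfI', hg', hij', hgx', rfl⟩ := hq
  refine ⟨i + i', j + j', f * f', g * g', SetLike.mul_mem_graded hf hf', I.mul_mem_left _ hfI',
    SetLike.mul_mem_graded hg hg', by push_cast; omega,
    fun h => ((ProjectiveSpectrum.isPrime x).mem_or_mem h).elim hgx hgx', ?_⟩
  rw [map_mul, map_mul, div_mul_div_comm]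

theorem stalkToF_mem_Fr (x : Proj 𝒜) (z : (Proj 𝒜).presheaf.stalk x) :
    stalkToF x z ∈ Fr 𝒜 ⊤ 0 x := by
  obtain ⟨U, hx, t, rfl⟩ := (Proj 𝒜).presheaf.exists_germ_eq z
  rw [stalkToF_germ]
  obtain ⟨i, f, g, hf, hg, V, hxV, -, hVg, h⟩ := evOF_frac t x hx
  exact ⟨i, i, f, g, hf, trivial, hg, (add_zero _).symm, hVg hxV, h x hxV hx⟩

theorem exists_stalkToF_eq {x : Proj 𝒜} {q : FractionRing A} (hq : q ∈ Fr 𝒜 ⊤ 0 x) :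
    ∃ z, stalkToF x z = q := by
  obtain ⟨i, j, f, g, hf, -, hg, hij, hgx, rfl⟩ := hq
  obtain rfl : i = j := by omega
  obtain ⟨t, ht⟩ := exists_function_eq_div (Proj.basicOpen 𝒜 g) i f g hf hg le_rfl
  have hx : x ∈ Proj.basicOpen 𝒜 g := hgx
  exact ⟨(Proj 𝒜).presheaf.germ _ x hx t, (stalkToF_germ t x hx).trans (ht x hx)⟩

theorem isUnit_iff_of_stalkToF_eq {x : Proj 𝒜} {z : (Proj 𝒜).presheaf.stalk x} {n : ℕ} {f g : A}
    (hf : f ∈ 𝒜 n) (hg : g ∈ 𝒜 n) (hgx : g ∉ x.asHomogeneousIdeal)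
    (h : stalkToF x z = algebraMap A (FractionRing A) f / algebraMap A (FractionRing A) g) :
    IsUnit z ↔ f ∉ x.asHomogeneousIdeal := by
  have hg0 : algebraMap A (FractionRing A) g ≠ 0 := algebraMap_ne_zero fun h => hgx (h ▸ zero_mem _)
  constructor
  · rintro hz hfx
    obtain ⟨w, hw⟩ := hz.exists_right_inv
    obtain ⟨i, j, a, b, ha, -, hb, hij, hbx, hab⟩ := stalkToF_mem_Fr x w
    have hb0 : algebraMap A (FractionRing A) b ≠ 0 :=
      algebraMap_ne_zero fun h => hbx (h ▸ zero_mem _)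
    have h1 := congrArg (stalkToF x) hw
    rw [map_mul, map_one, h, hab, div_mul_div_comm, div_eq_one_iff_eq (mul_ne_zero hg0 hb0),
      ← map_mul, ← map_mul, (IsFractionRing.injective A (FractionRing A)).eq_iff] at h1
    have h2 : g * b ∈ x.asHomogeneousIdeal.toIdeal := h1 ▸ Ideal.mul_mem_right a _ hfx
    exact ((ProjectiveSpectrum.isPrime x).mem_or_mem h2).elim hgx hbx
  · intro hfx
    have hf0 : algebraMap A (FractionRing A) f ≠ 0 :=
      algebraMap_ne_zero fun h => hfx (h ▸ zero_mem _)
    obtain ⟨w, hw⟩ := exists_stalkToF_eq (𝒜 := 𝒜) (x := x)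
      ⟨n, n, g, f, hg, trivial, hf, (add_zero _).symm, hfx, rfl⟩
    refine IsUnit.of_mul_eq_one w (stalkToF_injective x ?_)
    rw [map_mul, map_one, h, hw]
    field_simp

theorem mem_basicOpen_iff_of_evOF_eq {U : (Proj 𝒜).Opens} {s : Γ(Proj 𝒜, U)} {x : Proj 𝒜}
    (hx : x ∈ U) {n : ℕ} {f g : A}
    (hf : f ∈ 𝒜 n) (hg : g ∈ 𝒜 n) (hgx : g ∉ x.asHomogeneousIdeal)
    (h : evOF s x hx = algebraMap A (FractionRing A) f / algebraMap A (FractionRing A) g) :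
    x ∈ (Proj 𝒜).basicOpen s ↔ f ∉ x.asHomogeneousIdeal := by
  rw [Scheme.mem_basicOpen _ _ _ hx]
  exact isUnit_iff_of_stalkToF_eq hf hg hgx ((stalkToF_germ s x hx).trans h)

end Functions

/-! ### Dehomogenization on the standard charts -/

section Charts

variable {K : Type u} [Field K] {r : ℕ}

theorem chart_nonempty (i : Fin (r + 1)) : ∃ x : ProjSpace K r, x ∈ (chart (K := K) i).1 := by
  refine ⟨(⟨⊥, Ideal.isPrime_bot, fun h => ?_⟩ : ProjectiveSpectrum (grading K r)), ?_⟩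
  · exact MvPolynomial.X_ne_zero i (h (X_mem_irrelevant i))
  · exact fun h => MvPolynomial.X_ne_zero i (Ideal.mem_bot.1 h)

theorem evOF_dehomogenize (i : Fin (r + 1)) (n : ℕ) (f : CoordRing K r) (hf : f ∈ grading K r n)
    (x : ProjSpace K r) (hx : x ∈ (chart (K := K) i).1) :
    evOF (dehomogenize i n f hf) x hx = toFrac f /
      toFrac (MvPolynomial.X i) ^ n := by
  rw [← map_pow]
  exact evOF_awayToSection _ _ _ _ _ _

theorem mem_basicOpen_dehomogenize_iff (i : Fin (r + 1)) {n : ℕ} {f : CoordRing K r}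
    (hf : f ∈ grading K r n) {x : ProjSpace K r} (hx : x ∈ (chart (K := K) i).1) :
    x ∈ (ProjSpace K r).basicOpen (dehomogenize i n f hf) ↔ f ∉ x.asHomogeneousIdeal :=
  mem_basicOpen_iff_of_evOF_eq hx hf (X_pow_mem_grading i n)
    (fun h => hx ((ProjectiveSpectrum.isPrime x).mem_of_pow_mem _ h))
    ((evOF_dehomogenize i n f hf x hx).trans (by rw [map_pow]))

theorem exists_eq_dehomogenize (i : Fin (r + 1)) (s : Γ(ProjSpace K r, (chart (K := K) i).1)) :
    ∃ n f, ∃ hf : f ∈ grading K r n, s = dehomogenize i n f hf := by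
  obtain ⟨z, rfl⟩ := (Proj.basicOpenIsoAway (grading K r) _ (X_mem_grading (K := K) i)
    zero_lt_one).commRingCatIsoToRingEquiv.surjective s
  obtain ⟨n, f, hf, rfl⟩ :=
    HomogeneousLocalization.Away.mk_surjective _ (X_mem_grading (K := K) i) z
  exact ⟨n, f, by simpa using hf, rfl⟩

/-- The constant functions on the chart `x_i ≠ 0`. -/
def constHom (i : Fin (r + 1)) : K →+* Γ(ProjSpace K r, (chart (K := K) i).1) :=
  (Proj.awayToSection (grading K r) (MvPolynomial.X i)).hom.comp
    ((HomogeneousLocalization.fromZeroRingHom _ _).comp (algebraMap K (grading K r 0)))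

theorem evOF_constHom (i : Fin (r + 1)) (c : K) (x : ProjSpace K r)
    (hx : x ∈ (chart (K := K) i).1) : evOF (constHom i c) x hx =
      toFrac (MvPolynomial.C c) :=
  ((congrArg (toF x) (HomogeneousLocalization.val_mk _)).trans (toF_mk _ _ _)).trans (by
    change toFrac (MvPolynomial.C c) / toFrac 1 = _
    rw [map_one, div_one])

/-- The dehomogenization `x_i = 1`, from the coordinate ring to the functions on the chart
`x_i ≠ 0`. It agrees with `dehomogenize` on forms, and allows inhomogeneous elements. -/
def dehomHom (i : Fin (r + 1)) : CoordRing K r →+* Γ(ProjSpace K r, (chart (K := K) i).1) :=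
  MvPolynomial.eval₂Hom (constHom i)
    fun j => dehomogenize i 1 (MvPolynomial.X j) (X_mem_grading j)

theorem dehomHom_eq (i : Fin (r + 1)) {n : ℕ} {f : CoordRing K r} (hf : f ∈ grading K r n) :
    dehomHom i f = dehomogenize i n f hf := by
  obtain ⟨x, hx⟩ := chart_nonempty (K := K) i
  refine eq_of_evOF_eq x hx ?_
  rw [← evOFHom_apply, dehomHom, MvPolynomial.coe_eval₂Hom, MvPolynomial.eval₂_eq', map_sum,
    evOF_dehomogenize]
  conv_rhs => rw [f.as_sum, map_sum, Finset.sum_div]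
  refine Finset.sum_congr rfl fun d hd => ?_
  have hdn : ∑ j, d j = n := by
    have := hf (MvPolynomial.mem_support_iff.1 hd)
    rw [Finsupp.weight_apply, Finsupp.sum_fintype _ _ (by simp)] at this
    simpa using this
  rw [map_mul, map_prod]
  simp only [map_pow, evOFHom_apply, evOF_dehomogenize, evOF_constHom, pow_one, div_pow]
  rw [Finset.prod_div_distrib, Finset.prod_pow_eq_pow_sum, hdn, MvPolynomial.monomial_eq,
    map_mul, Finsupp.prod_fintype _ _ (by simp), map_prod]
  simp only [map_pow, mul_div_assoc]

end Charts

/-! ### The saturated ideal of a closed subscheme -/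

section SatIdeal

variable {K : Type u} [Field K] {r : ℕ} (D : (ProjSpace K r).IdealSheafData)

theorem isHomogeneous_satIdeal : (satIdeal D).IsHomogeneous (grading K r) :=
  Ideal.homogeneous_span _ _ fun _ ⟨n, hf, _⟩ => ⟨n, hf⟩

theorem dehomHom_mem_ideal {f : CoordRing K r} (h : f ∈ satIdeal D) (i : Fin (r + 1)) :
    dehomHom i f ∈ D.ideal (chart i) := by
  have : satIdeal D ≤ (D.ideal (chart i)).comap (dehomHom i) := Ideal.span_le.2 fun g hg => by
    obtain ⟨n, hgn, hg⟩ := hg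
    change dehomHom i g ∈ D.ideal (chart i)
    rw [dehomHom_eq i hgn]
    exact hg i
  exact this h

theorem mem_satIdeal_of_dehomHom {n : ℕ} {f : CoordRing K r} (hf : f ∈ grading K r n)
    (h : ∀ i, dehomHom i f ∈ D.ideal (chart i)) : f ∈ satIdeal D :=
  Ideal.subset_span ⟨n, hf, fun i => dehomHom_eq i hf ▸ h i⟩

theorem dehomHom_X_self (i : Fin (r + 1)) :
    dehomHom i (MvPolynomial.X i : CoordRing K r) = 1 := by
  obtain ⟨x, hx⟩ := chart_nonempty (K := K) i
  refine eq_of_evOF_eq x hx ?_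
  rw [dehomHom_eq i (X_mem_grading i), evOF_dehomogenize, pow_one,
    div_self (algebraMap_ne_zero (MvPolynomial.X_ne_zero i)), ← evOFHom_apply, map_one]

/-- `satIdeal D` is saturated, as `x_i` becomes `1` on the chart `x_i ≠ 0`. -/
theorem mem_satIdeal_of_X_pow_mul {f : CoordRing K r}
    (h : ∀ i, ∃ M, MvPolynomial.X i ^ M * f ∈ satIdeal D) : f ∈ satIdeal D := by
  classical
  rw [← DirectSum.sum_support_decompose (grading K r) f]
  refine Ideal.sum_mem _ fun n _ => ?_
  refine mem_satIdeal_of_dehomHom D (SetLike.coe_mem _) fun i => ?_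
  obtain ⟨M, hM⟩ := h i
  have h1 := isHomogeneous_satIdeal D (M + n) hM
  rw [DirectSum.coe_decompose_mul_add_of_left_mem (grading K r) (X_pow_mem_grading i M)] at h1
  have h2 := dehomHom_mem_ideal D h1 i
  rwa [map_mul, map_pow, dehomHom_X_self, one_pow, one_mul] at h2

theorem basicOpen_dehomogenize_le (i j : Fin (r + 1)) :
    (ProjSpace K r).basicOpen (dehomogenize j 1 (MvPolynomial.X i : CoordRing K r)
      (X_mem_grading i)) ≤ (chart (K := K) i).1 := by
  intro x hx hxi
  have hxj : x ∈ (chart (K := K) j).1 := (ProjSpace K r).basicOpen_le _ hx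
  exact (mem_basicOpen_dehomogenize_iff j (X_mem_grading i) hxj).1 hx hxi

/-- Sections of an ideal sheaf extend from `D(t)` after multiplication by a power of `t`. -/
theorem exists_mul_pow_mem_ideal {X : Scheme.{u}} (D : X.IdealSheafData) {U V : X.affineOpens}
    (t : Γ(X, U.1)) (h : X.affineBasicOpen t ≤ V) {s : Γ(X, V.1)} (hs : s ∈ D.ideal V) :
    ∃ a ∈ D.ideal U, ∃ N : ℕ,
      X.presheaf.map (homOfLE (show X.basicOpen t ≤ V.1 from h)).op s *
        X.presheaf.map (homOfLE (X.basicOpen_le t)).op (t ^ N) =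
      X.presheaf.map (homOfLE (X.basicOpen_le t)).op a := by
  have h1 := D.ideal_le_comap_ideal h hs
  rw [Ideal.mem_comap, ← D.map_ideal_basicOpen] at h1
  have := U.2.isLocalization_basicOpen t
  obtain ⟨⟨a, ⟨_, N, rfl⟩⟩, h2⟩ := (IsLocalization.mem_map_algebraMap_iff (.powers t)
    Γ(X, X.basicOpen t)).1 h1
  exact ⟨a.1, a.2, N, h2⟩

/-- Every local equation of `D` on a standard chart is the dehomogenization of a form in
`satIdeal D`: multiplying by a power of `x_i` clears the denominators on the other charts. -/
theorem exists_mem_satIdeal (i : Fin (r + 1)) {s : Γ(ProjSpace K r, (chart (K := K) i).1)}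
    (hs : s ∈ D.ideal (chart i)) :
    ∃ n f, ∃ hf : f ∈ grading K r n, f ∈ satIdeal D ∧ s = dehomogenize i n f hf := by
  obtain ⟨n, f, hf, rfl⟩ := exists_eq_dehomogenize i s
  have key (j : Fin (r + 1)) : ∃ N, dehomHom j (f * MvPolynomial.X i ^ N) ∈ D.ideal (chart j) := by
    set t := dehomogenize j 1 (MvPolynomial.X i : CoordRing K r) (X_mem_grading i) with ht
    have hti : (ProjSpace K r).affineBasicOpen t ≤ chart i := basicOpen_dehomogenize_le i j
    obtain ⟨a, ha, N, h2⟩ := exists_mul_pow_mem_ideal D t hti hs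
    refine ⟨N, ?_⟩
    have h3 : dehomHom j (f * MvPolynomial.X i ^ N) = a * t ^ n := by
      obtain ⟨z, hz⟩ := chart_nonempty (K := K) j
      have hx : genPt z ∈ (chart (K := K) j).1 := genPt_mem z hz
      have hxi : (MvPolynomial.X i : CoordRing K r) ∉ (genPt z).asHomogeneousIdeal :=
        fun h => MvPolynomial.X_ne_zero i ((mem_genPt_iff z _).1 h)
      have hxt : genPt z ∈ (ProjSpace K r).basicOpen t :=
        (mem_basicOpen_dehomogenize_iff j (X_mem_grading i) hx).2 hxi
      refine eq_of_evOF_eq _ hx ?_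
      have h4 := congrArg (evOFHom _ (genPt z) hxt) h2
      rw [map_mul, evOFHom_apply, evOFHom_apply, evOFHom_apply, evOF_map, evOF_map, evOF_map,
        ← evOFHom_apply _ _ _ (t ^ N), ← evOFHom_apply _ _ _ a] at h4
      rw [dehomHom_eq j (SetLike.mul_mem_graded hf (X_pow_mem_grading i N)),
        ← evOFHom_apply _ _ _ (a * t ^ n), map_mul (evOFHom _ _ _), ← h4,
        map_pow (evOFHom _ _ _), map_pow (evOFHom _ _ _), evOFHom_apply,
        evOF_dehomogenize, evOF_dehomogenize, evOF_dehomogenize, pow_one, div_pow, div_pow,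
        map_mul, map_pow]
      have h5 : toFrac (MvPolynomial.X i : CoordRing K r) ≠ 0 :=
        algebraMap_ne_zero (MvPolynomial.X_ne_zero i)
      have h6 : toFrac (MvPolynomial.X j : CoordRing K r) ≠ 0 :=
        algebraMap_ne_zero (MvPolynomial.X_ne_zero j)
      field_simp
      ring
    rw [h3]
    exact Ideal.mul_mem_right _ _ ha
  choose N hN using key
  have hfN : f * MvPolynomial.X i ^ (∑ j, N j) ∈ grading K r (n + ∑ j, N j) :=
    SetLike.mul_mem_graded hf (X_pow_mem_grading i _)
  refine ⟨_, _, hfN, mem_satIdeal_of_dehomHom D hfN fun j => ?_, ?_⟩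
  · rw [← Finset.add_sum_erase _ _ (Finset.mem_univ j), pow_add, ← mul_assoc, map_mul]
    exact Ideal.mul_mem_right _ _ (hN j)
  · rw [← dehomHom_eq, ← dehomHom_eq, map_mul, map_pow, dehomHom_X_self, one_pow, mul_one]

theorem mem_support_iff_satIdeal_le (x : ProjSpace K r) :
    x ∈ D.support ↔ satIdeal D ≤ x.asHomogeneousIdeal.toIdeal := by
  obtain ⟨i, hi⟩ := exists_X_notMem x
  have hx : x ∈ (chart (K := K) i).1 := hi
  rw [D.mem_support_iff_of_mem hx, Scheme.mem_zeroLocus_iff]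
  constructor
  · intro h
    by_contra hc
    obtain ⟨n, f, hf, hfI, hfx⟩ := exists_homogeneous_notMem (isHomogeneous_satIdeal D) hc
    refine h (dehomogenize i n f hf) ?_ ((mem_basicOpen_dehomogenize_iff i hf hx).2 hfx)
    rw [← dehomHom_eq]
    exact dehomHom_mem_ideal D hfI i
  · intro h s hs hxs
    obtain ⟨n, f, hf, hfI, rfl⟩ := exists_mem_satIdeal D i hs
    exact (mem_basicOpen_dehomogenize_iff i hf hx).1 hxs (h hfI)

/-- The stalk of an ideal sheaf can be computed on any one affine neighbourhood. -/
theorem stalkIdeal_eq_map {X : Scheme.{u}} (D : X.IdealSheafData) (x : X) (U : X.affineOpens)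
    (hx : x ∈ U.1) : stalkIdeal D x = (D.ideal U).map (X.presheaf.germ U.1 x hx).hom := by
  refine le_antisymm (iSup₂_le fun V hxV => ?_)
    (le_iSup₂ (f := fun (U : X.affineOpens) (hx : x ∈ U.1) =>
      (D.ideal U).map (X.presheaf.germ U.1 x hx).hom) U hx)
  obtain ⟨f, g, hfg, hxf⟩ := exists_basicOpen_le_affine_inter U.2 V.2 x ⟨hx, hxV⟩
  have h1 (W W' : X.affineOpens) (hxW : x ∈ W.1) (hle : W ≤ W') :
      (D.ideal W).map (X.presheaf.germ W.1 x hxW).hom =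
        (D.ideal W').map (X.presheaf.germ W'.1 x (hle hxW)).hom := by
    rw [← D.map_ideal hle, Ideal.map_map, ← CommRingCat.hom_comp]
    congr 2
    exact (X.presheaf.germ_res (homOfLE (show W.1 ≤ W'.1 from hle)) x hxW)
  rw [← h1 (X.affineBasicOpen f) U hxf (X.affineBasicOpen_le f),
    h1 (X.affineBasicOpen f) V hxf (hfg.trans_le (X.basicOpen_le g))]

/-- The stalk of the ideal sheaf of `D` consists of the fractions of degree `0` whose numerator
lies in `satIdeal D`. -/
theorem mem_stalkIdeal_iff (x : ProjSpace K r) (z : (ProjSpace K r).presheaf.stalk x) :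
    z ∈ stalkIdeal D x ↔ stalkToF x z ∈ Fr (grading K r) (satIdeal D) 0 x := by
  obtain ⟨i, hi⟩ := exists_X_notMem x
  have hx : x ∈ (chart (K := K) i).1 := hi
  rw [stalkIdeal_eq_map D x (chart i) hx]
  constructor
  · intro h
    rw [Ideal.map] at h
    induction h using Submodule.span_induction with
    | mem z hz =>
      obtain ⟨s, hs, rfl⟩ := hz
      obtain ⟨n, f, hf, hfI, rfl⟩ := exists_mem_satIdeal D i hs
      refine ⟨n, n, f, MvPolynomial.X i ^ n, hf, hfI, X_pow_mem_grading i n, (add_zero _).symm,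
        fun h => hi ((ProjectiveSpectrum.isPrime x).mem_of_pow_mem _ h), ?_⟩
      rw [map_pow]
      exact (stalkToF_germ _ x hx).trans (evOF_dehomogenize i n f hf x hx)
    | zero => rw [map_zero]; exact zero_mem_Fr _ _ _
    | add a b _ _ ha hb => rw [map_add]; exact add_mem_Fr ha hb
    | smul a b _ hb =>
      rw [smul_eq_mul, map_mul]
      exact mul_mem_Fr_of_mem_of_mem (stalkToF_mem_Fr x a) hb
  · rintro ⟨n, n', f, g, hf, hfI, hg, hn, hgx, hz⟩
    obtain rfl : n = n' := by omega
    have hg0 : toFrac g ≠ 0 :=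
      algebraMap_ne_zero fun h => hgx (h ▸ zero_mem _)
    have h6 : toFrac (MvPolynomial.X i : CoordRing K r) ≠ 0 :=
      algebraMap_ne_zero (MvPolynomial.X_ne_zero i)
    obtain ⟨w, hw⟩ := exists_stalkToF_eq (𝒜 := grading K r) (x := x)
      ⟨n, n, MvPolynomial.X i ^ n, g, X_pow_mem_grading i n, trivial, hg, (add_zero _).symm, hgx,
        rfl⟩
    have : z = w * (ProjSpace K r).presheaf.germ (chart i).1 x hx (dehomogenize i n f hf) := by
      apply stalkToF_injective
      rw [map_mul, hz, hw, stalkToF_germ, evOF_dehomogenize, map_pow]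
      field_simp
    rw [this]
    refine Ideal.mul_mem_left _ _ (Ideal.mem_map_of_mem _ ?_)
    rw [← dehomHom_eq]
    exact dehomHom_mem_ideal D hfI i

/-- An inclusion of saturated ideals gives an inclusion of ideal sheaves. -/
theorem le_pow_of_satIdeal_le_pow {D Y : (ProjSpace K r).IdealSheafData} {n : ℕ}
    (h : satIdeal D ≤ satIdeal Y ^ n) : D ≤ Y ^ n := by
  refine Scheme.IdealSheafData.le_of_iSup_eq_top (chart (K := K)) ?_ fun i s hs => ?_
  · refine top_le_iff.1 fun x _ => Opens.mem_iSup.2 ?_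
    exact exists_X_notMem x
  · obtain ⟨m, f, hf, hfI, rfl⟩ := exists_mem_satIdeal D i hs
    rw [← dehomHom_eq]
    have h1 : satIdeal Y ≤ (Y.ideal (chart i)).comap (dehomHom i) :=
      fun g hg => dehomHom_mem_ideal Y hg i
    exact (Ideal.pow_right_mono h1 n).trans (Ideal.le_comap_pow _ _) (h hfI)

end SatIdeal

/-! ### Points of codimension at most two -/

section Codimension

variable {K : Type u} [Field K] {r : ℕ} {D : (ProjSpace K r).IdealSheafData}

theorem le_iff_asHomogeneousIdeal_le {x y : ProjSpace K r} :
    x ≤ y ↔ y.asHomogeneousIdeal.toIdeal ≤ x.asHomogeneousIdeal.toIdeal :=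
  Scheme.le_iff_specializes.trans (specializes_iff_mem_closure.trans
    (ProjectiveSpectrum.le_iff_mem_closure (𝒜 := grading K r) y x).symm)

/-- A nonzero homogeneous prime contained in a principal prime `(p)` equals `(p)`, as it contains
a prime element. -/
theorem coheight_le_one_of_prime {x : ProjSpace K r} {p : CoordRing K r}
    (hp : Prime p) (hx : ∀ f, f ∈ x.asHomogeneousIdeal ↔ p ∣ f) : Order.coheight x ≤ 1 := by
  refine Order.coheight_le_coe_iff.2 fun y hy => ?_
  have hle := le_iff_asHomogeneousIdeal_le.1 hy.le
  have hy0 : y.asHomogeneousIdeal.toIdeal = ⊥ := by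
    by_contra hne
    obtain ⟨q, hqy, hq⟩ := (ProjectiveSpectrum.isPrime y).exists_mem_prime_of_ne_bot hne
    have hpq : p ∣ q := (hx q).1 (hle hqy)
    refine hy.not_ge (le_iff_asHomogeneousIdeal_le.2 fun f hf => ?_)
    exact Ideal.mem_of_dvd _ ((hp.associated_of_dvd hq hpq).symm.dvd.trans ((hx f).1 hf)) hqy
  rw [Nat.cast_one, Order.lt_one_iff, Order.coheight_eq_zero]
  intro z hz
  rw [le_iff_asHomogeneousIdeal_le, hy0]
  exact bot_le

theorem le_coheight_of_mem_support {n : ℕ∞} (h : codim D = n) {x : ProjSpace K r}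
    (hx : x ∈ D.support) :
    n ≤ Order.coheight x := by
  rw [← h]; exact iInf₂_le x hx

/-- A closed subscheme of codimension two contains no hypersurface. -/
theorem not_satIdeal_le_of_prime (h : codim D = 2) {x : ProjSpace K r} {p : CoordRing K r}
    (hp : Prime p) (hx : ∀ f, f ∈ x.asHomogeneousIdeal ↔ p ∣ f) :
    ¬ satIdeal D ≤ x.asHomogeneousIdeal.toIdeal := by
  rw [← mem_support_iff_satIdeal_le]
  intro hxD
  have h1 : (2 : ℕ∞) ≤ Order.coheight x := le_coheight_of_mem_support h hxD
  exact absurd (h1.trans (coheight_le_one_of_prime hp hx)) (by decide)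

theorem exists_coheight_eq_two (h : codim D = 2) : ∃ x ∈ D.support, Order.coheight x = 2 := by
  by_contra! hc
  have : (3 : ℕ∞) ≤ codim D := le_iInf₂ fun x hx => by
    have h1 : (2 : ℕ∞) ≤ Order.coheight x := le_coheight_of_mem_support h hx
    exact Order.add_one_le_of_lt (lt_of_le_of_ne h1 (hc x hx).symm)
  rw [h] at this
  exact absurd this (by decide)

/-- Points of codimension two are generic in a closed subscheme of codimension two. -/
theorem eq_of_specializes (h : codim D = 2) {x z : ProjSpace K r} (hx : Order.coheight x = 2)
    (hz : z ∈ D.support) (hzx : z ⤳ x) : z = x := by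
  by_contra hne
  have h1 : (2 : ℕ∞) ≤ Order.coheight z := le_coheight_of_mem_support h hz
  have h2 : x < z := lt_of_le_not_ge (Scheme.le_iff_specializes.2 hzx) fun hle =>
    hne (hzx.antisymm (Scheme.le_iff_specializes.1 hle)).eq
  have h3 := Order.coheight_add_one_le h2
  rw [hx] at h3
  exact absurd ((add_le_add_left h1 1).trans h3) (by decide)

end Codimension

/-! ### Ideals generated by regular sequences in a local domain -/

section LocalAlgebra

open RingTheory.Sequence

variable {S : Type*} [CommRing S]

theorem IsWeaklyRegular.mem_of_mul_mem {rs : List S} (h : IsWeaklyRegular S rs) {i : ℕ}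
    (hi : i < rs.length) {c : S} (hc : rs[i] * c ∈ Ideal.ofList (rs.take i)) :
    c ∈ Ideal.ofList (rs.take i) := by
  have h1 := h.regular_mod_prev i hi
  rw [isSMulRegular_quotient_iff_mem_of_smul_mem] at h1
  simpa using h1 c (by simpa using hc)

open IsLocalRing in
/-- An ideal `I` such that `I × I` is generated by three elements is principal. -/
theorem exists_eq_span_singleton_of_prod [IsLocalRing S] {I : Ideal S} (e : Fin 3 → I × I)
    (he : Submodule.span S (Set.range e) = ⊤) : ∃ c, I = Ideal.span {c} := by
  let m := maximalIdeal S
  let : Field (S ⧸ m) := Ideal.Quotient.field m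
  let V := I ⧸ (m • (⊤ : Submodule S I))
  let q : I →ₗ[S] V := Submodule.mkQ _
  have hq : Function.Surjective q := Submodule.mkQ_surjective _
  have hspan : Submodule.span (S ⧸ m) (Set.range fun i => q.prodMap q (e i)) = ⊤ := by
    have h1 : Submodule.span S (Set.range fun i => q.prodMap q (e i)) = ⊤ := by
      rw [Set.range_comp' (q.prodMap q) e, Submodule.span_image, he, Submodule.map_top,
        LinearMap.range_eq_top]
      exact hq.prodMap hq
    have h2 := Submodule.span_le_restrictScalars S (S ⧸ m) (Set.range fun i => q.prodMap q (e i))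
    rw [h1] at h2
    exact top_le_iff.1 fun x _ => h2 trivial
  have hfin : Module.Finite (S ⧸ m) (V × V) :=
    ⟨⟨(Set.finite_range _).toFinset, by simpa using hspan⟩⟩
  have hfinV : Module.Finite (S ⧸ m) V :=
    Module.Finite.of_surjective (LinearMap.fst (S ⧸ m) V V) LinearMap.fst_surjective
  have h1 : Module.finrank (S ⧸ m) (V × V) ≤ 3 := by
    have := finrank_range_le_card (R := S ⧸ m) (b := fun i => q.prodMap q (e i))
    rw [Set.finrank, hspan, finrank_top] at this
    simpa using this
  rw [Module.finrank_prod] at h1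
  obtain ⟨v, hv⟩ := (finrank_le_one_iff (K := S ⧸ m) (V := V)).1 (by omega)
  obtain ⟨c, rfl⟩ := hq v
  refine ⟨c, le_antisymm ?_ ((Ideal.span_singleton_le_iff_mem _).2 c.2)⟩
  have hfg : I.FG := by
    have h2 : Module.Finite S (I × I) := ⟨⟨(Set.finite_range e).toFinset, by simpa using he⟩⟩
    exact Module.Finite.iff_fg.1
      (Module.Finite.of_surjective (LinearMap.fst S I I) LinearMap.fst_surjective)
  refine Submodule.le_of_le_smul_of_le_jacobson_bot (I := m) hfg (maximalIdeal_le_jacobson _) ?_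
  intro x hx
  obtain ⟨k, hk⟩ := hv (q ⟨x, hx⟩)
  obtain ⟨k, rfl⟩ := Ideal.Quotient.mk_surjective k
  have h2 : q (⟨x, hx⟩ - k • c) = 0 := by
    rw [map_sub, map_smul, sub_eq_zero]
    exact hk.symm
  rw [Submodule.mkQ_apply, Submodule.Quotient.mk_eq_zero] at h2
  have h3 := Submodule.mem_map_of_mem (f := I.subtype) h2
  rw [Submodule.map_smul'', Submodule.map_top, Submodule.range_subtype] at h3
  refine Submodule.mem_sup.2 ⟨k * c.1, Ideal.mem_span_singleton'.2 ⟨k, rfl⟩, _, h3, ?_⟩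
  simp

variable [IsDomain S]

/-- No sequence of length at least three in `αI + βI` is regular: the determinant of the
coefficients of the first two elements multiplies `αI + βI` into the ideal they generate, without
belonging to it. -/
theorem not_isWeaklyRegular_of_mem {I : Ideal S} (hI : I ≠ ⊤) {α β : S} (hα : α ∈ I) (hβ : β ∈ I)
    {x y z : S} {l : List S} (h : IsWeaklyRegular S (x :: y :: z :: l))
    (hx : x ∈ combIdeal I α β) (hy : y ∈ combIdeal I α β) (hz : z ∈ combIdeal I α β) : False := by
  obtain ⟨a₁, -, b₁, -, hx⟩ := mem_combIdeal.1 hx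
  obtain ⟨a₂, -, b₂, -, hy⟩ := mem_combIdeal.1 hy
  obtain ⟨a₃, -, b₃, -, hz⟩ := mem_combIdeal.1 hz
  have hx0 : x ≠ 0 := by
    rintro rfl
    have := IsWeaklyRegular.mem_of_mul_mem h (i := 0) (by simp) (c := 1) (by simp)
    simp at this
  have hy1 (c d : S) (hc : y * c = x * d) : ∃ e, c = x * e := by
    have := IsWeaklyRegular.mem_of_mul_mem h (i := 1) (by simp) (c := c)
      (by simpa [Ideal.mem_span_singleton] using ⟨d, hc⟩)
    simpa [Ideal.mem_span_singleton, dvd_def] using this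
  have hz1 : ∃ s t, a₁ * b₂ - a₂ * b₁ = x * s + y * t := by
    have := IsWeaklyRegular.mem_of_mul_mem h (i := 2) (by simp) (c := a₁ * b₂ - a₂ * b₁) (by
      simp only [List.take_succ_cons, List.take_zero, Ideal.ofList_cons, Ideal.ofList_nil, bot_le,
        sup_of_le_left,
        List.getElem_cons_succ, List.getElem_cons_zero, ← Ideal.span_insert]
      refine Ideal.mem_span_pair.2 ⟨b₂ * a₃ - a₂ * b₃, a₁ * b₃ - b₁ * a₃, ?_⟩
      rw [hx, hy, hz]
      ring)
    simp only [List.take_succ_cons, List.take_zero, Ideal.ofList_cons, Ideal.ofList_nil, bot_le,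
        sup_of_le_left,
      ← Ideal.span_insert] at this
    obtain ⟨s, t, hst⟩ := Ideal.mem_span_pair.1 this
    exact ⟨s, t, by rw [← hst]; ring⟩
  obtain ⟨s, t, hst⟩ := hz1
  obtain ⟨c, hc⟩ := hy1 (b₁ + α * t) (b₂ - α * s) (by
    rw [mul_add, mul_sub]; linear_combination (-α) * hst + b₁ * hy - b₂ * hx)
  obtain ⟨d, hd⟩ := hy1 (a₁ - β * t) (a₂ + β * s) (by
    linear_combination β * hst + a₁ * hy - a₂ * hx)
  have h1 : α * d + β * c = 1 :=
    mul_left_cancel₀ hx0 (by linear_combination (-α) * hd - β * hc - hx)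
  exact hI ((Ideal.eq_top_iff_one I).2
    (h1 ▸ I.add_mem (I.mul_mem_right _ hα) (I.mul_mem_right _ hβ)))

variable [IsLocalRing S]

/-- `αI + βI` is not generated by two elements: otherwise, by the Koszul relation between `α` and
`β`, three elements generate `I × I`, and then `I` is a principal ideal whose generator divides
both `α` and `β`. -/
theorem not_le_span_pair {I : Ideal S} (hI : I ≠ ⊤) {α β : S} (hα : α ∈ I) (hβ : β ∈ I)
    (hK : ∀ u v, α * u + β * v = 0 → ∃ w, u = β * w ∧ v = -(α * w))
    {x y : S} (hx : x ∈ combIdeal I α β) (hy : y ∈ combIdeal I α β) :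
    ¬ combIdeal I α β ≤ Ideal.span {x, y} := by
  intro hle
  obtain ⟨a₁, ha₁, b₁, hb₁, hx⟩ := mem_combIdeal.1 hx
  obtain ⟨a₂, ha₂, b₂, hb₂, hy⟩ := mem_combIdeal.1 hy
  obtain ⟨c, rfl⟩ := exists_eq_span_singleton_of_prod (I := I)
    ![(⟨a₁, ha₁⟩, ⟨b₁, hb₁⟩), (⟨a₂, ha₂⟩, ⟨b₂, hb₂⟩), (⟨β, hβ⟩, ⟨-α, neg_mem hα⟩)] (by
    refine top_le_iff.1 ?_
    rintro ⟨⟨u, hu⟩, ⟨v, hv⟩⟩ -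
    obtain ⟨p, q, hpq⟩ := Ideal.mem_span_pair.1 (hle (mem_combIdeal.2 ⟨u, hu, v, hv, rfl⟩))
    obtain ⟨w, hw₁, hw₂⟩ := hK (u - (p * a₁ + q * a₂)) (v - (p * b₁ + q * b₂))
      (by linear_combination -hpq + p * hx + q * hy)
    rw [Submodule.mem_span_range_iff_exists_fun]
    refine ⟨![p, q, w], ?_⟩
    ext
    · simp [Fin.sum_univ_three]
      linear_combination -hw₁
    · simp [Fin.sum_univ_three]
      linear_combination -hw₂)
  obtain ⟨α', hα'⟩ := Ideal.mem_span_singleton.1 hα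
  obtain ⟨β', hβ'⟩ := Ideal.mem_span_singleton.1 hβ
  obtain ⟨w, hw₁, hw₂⟩ := hK β' (-α') (by rw [hα', hβ']; ring)
  refine hI (Ideal.span_singleton_eq_top.2 (IsUnit.of_mul_eq_one w ?_))
  by_contra hcw
  have hne : c * w - 1 ≠ 0 := sub_ne_zero.2 hcw
  have h1 : β' = 0 := (mul_eq_zero.1 (show (c * w - 1) * β' = 0 by
    rw [hβ'] at hw₁; linear_combination -hw₁)).resolve_left hne
  have h2 : α' = 0 := (mul_eq_zero.1 (show (c * w - 1) * α' = 0 by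
    rw [hα'] at hw₂; linear_combination hw₂)).resolve_left hne
  -- Both coefficients vanish, so that every pair is a syzygy.
  rw [hα', hβ', h1, h2] at hK
  obtain ⟨w, hw, -⟩ := hK 1 1 (by ring)
  simp at hw

/-- `αI + βI` is not generated by a regular sequence, whatever its length. -/
theorem ofList_ne_combIdeal {I : Ideal S} (hI : I ≠ ⊤) {α β : S} (hα : α ∈ I) (hβ : β ∈ I)
    (hK : ∀ u v, α * u + β * v = 0 → ∃ w, u = β * w ∧ v = -(α * w))
    {rs : List S} (h : IsWeaklyRegular S rs) : Ideal.ofList rs ≠ combIdeal I α β := by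
  intro he
  have hmem (s) (hs : s ∈ rs) : s ∈ combIdeal I α β := he ▸ Ideal.subset_span hs
  match rs, h with
  | [], _ => exact not_le_span_pair hI hα hβ hK (zero_mem _) (zero_mem _) (by simp [← he])
  | [x], _ =>
    exact not_le_span_pair hI hα hβ hK (hmem x (by simp)) (zero_mem _)
      (by simp [← he, Ideal.span_insert])
  | [x, y], _ =>
    exact not_le_span_pair hI hα hβ hK (hmem x (by simp)) (hmem y (by simp))
      (by simp [← he, Ideal.span_insert])
  | x :: y :: z :: l, h =>
    exact not_isWeaklyRegular_of_mem hI hα hβ h (hmem x (by simp)) (hmem y (by simp))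
      (hmem z (by simp))

end LocalAlgebra

/-! ### The stalks of `αI + βI` -/

section Stalks

variable {K : Type u} [Field K] {r : ℕ} {Y D : (ProjSpace K r).IdealSheafData}

instance isDomain_stalk (x : ProjSpace K r) : IsDomain ((ProjSpace K r).presheaf.stalk x) :=
  (stalkToF_injective x).isDomain

theorem stalkIdeal_ne_top {x : ProjSpace K r} (hx : x ∈ Y.support) : stalkIdeal Y x ≠ ⊤ := by
  rw [Ne, Ideal.eq_top_iff_one, mem_stalkIdeal_iff, map_one]
  rintro ⟨i, j, f, g, hf, hfI, hg, hij, hgx, h⟩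
  have hg0 := algebraMap_ne_zero (ne_zero_of_notMem hgx)
  rw [eq_comm, div_eq_one_iff_eq hg0,
    (IsFractionRing.injective (CoordRing K r) (FractionRing (CoordRing K r))).eq_iff] at h
  exact hgx (h ▸ (mem_support_iff_satIdeal_le Y x).1 hx hfI)

/-- The homogeneous elements of `αI + βI` have homogeneous coefficients. -/
theorem exists_homogeneous_of_mem_combIdeal {I : Ideal (CoordRing K r)}
    (hI : I.IsHomogeneous (grading K r)) {m n : ℕ} {α β f : CoordRing K r}
    (hα : α ∈ grading K r m) (hβ : β ∈ grading K r m) (hf : f ∈ grading K r n)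
    (hfI : f ∈ combIdeal I α β) : f = 0 ∨ ∃ k u v, n = m + k ∧ u ∈ grading K r k ∧
      v ∈ grading K r k ∧ u ∈ I ∧ v ∈ I ∧ f = α * u + β * v := by
  obtain ⟨u, hu, v, hv, rfl⟩ := mem_combIdeal.1 hfI
  have h1 := DirectSum.decompose_of_mem_same (grading K r) hf
  rw [DirectSum.decompose_add, DirectSum.add_apply, Submodule.coe_add] at h1
  by_cases hmn : m ≤ n
  · obtain ⟨k, rfl⟩ := Nat.exists_eq_add_of_le hmn
    rw [DirectSum.coe_decompose_mul_add_of_left_mem (grading K r) hα,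
      DirectSum.coe_decompose_mul_add_of_left_mem (grading K r) hβ] at h1
    exact Or.inr ⟨k, _, _, rfl, SetLike.coe_mem _, SetLike.coe_mem _, hI k hu, hI k hv, h1.symm⟩
  · rw [DirectSum.coe_decompose_mul_of_left_mem_of_not_le (grading K r) hα hmn,
      DirectSum.coe_decompose_mul_of_left_mem_of_not_le (grading K r) hβ hmn, add_zero] at h1
    exact Or.inl h1.symm

/-- The relation `I_D = α I_Y + β I_Y` passes to the stalks, where `α` and `β` are divided by a form
`q` of the same degree. -/
theorem stalkIdeal_eq_combIdeal {m : ℕ} {α β : CoordRing K r}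
    (hα : α ∈ grading K r m) (hβ : β ∈ grading K r m)
    (h : satIdeal D = combIdeal (satIdeal Y) α β) {x : ProjSpace K r} {q : CoordRing K r}
    (hq : q ∈ grading K r m) (hqx : q ∉ x.asHomogeneousIdeal)
    {α' β' : (ProjSpace K r).presheaf.stalk x}
    (hα' : stalkToF x α' = toFrac α /
      toFrac q)
    (hβ' : stalkToF x β' = toFrac β /
      toFrac q) :
    stalkIdeal D x = combIdeal (stalkIdeal Y x) α' β' := by
  have hq0 := algebraMap_ne_zero (ne_zero_of_notMem hqx)
  ext z
  rw [mem_stalkIdeal_iff, mem_combIdeal, h]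
  constructor
  · rintro ⟨i, j, f, g, hf, hfI, hg, hij, hgx, hz⟩
    obtain rfl | ⟨k, u, v, hk, hu, hv, huI, hvI, rfl⟩ :=
      exists_homogeneous_of_mem_combIdeal (isHomogeneous_satIdeal Y) hα hβ hf hfI
    · have : z = 0 := stalkToF_injective x (by rw [hz]; simp)
      exact ⟨0, zero_mem _, 0, zero_mem _, by rw [this]; ring⟩
    · obtain rfl : j = m + k := by omega
      have hg0 := algebraMap_ne_zero (ne_zero_of_notMem hgx)
      have key (u : CoordRing K r) (hu : u ∈ grading K r k) (huI : u ∈ satIdeal Y) :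
          ∃ u' ∈ stalkIdeal Y x, stalkToF x u' =
            toFrac (q * u) /
            toFrac g := by
        obtain ⟨u', hu'⟩ := exists_stalkToF_eq (𝒜 := grading K r) (x := x)
          ⟨m + k, m + k, q * u, g, SetLike.mul_mem_graded hq hu, trivial, hg, (add_zero _).symm,
            hgx, rfl⟩
        exact ⟨u', (mem_stalkIdeal_iff Y x u').2 ⟨m + k, m + k, q * u, g,
          SetLike.mul_mem_graded hq hu, Ideal.mul_mem_left _ _ huI, hg, (add_zero _).symm,
          hgx, hu'⟩, hu'⟩
      obtain ⟨u', hu', e₁⟩ := key u hu huI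
      obtain ⟨v', hv', e₂⟩ := key v hv hvI
      refine ⟨u', hu', v', hv', stalkToF_injective x ?_⟩
      rw [hz, map_add (stalkToF x), map_mul (stalkToF x), map_mul (stalkToF x), e₁, e₂, hα', hβ']
      simp only [map_add, map_mul]
      field_simp
  · rintro ⟨u, hu, v, hv, rfl⟩
    rw [mem_stalkIdeal_iff] at hu hv
    have key {a : CoordRing K r} (ha : a ∈ grading K r m)
        (haI : ∀ u ∈ satIdeal Y, a * u ∈ combIdeal (satIdeal Y) α β)
        {p : FractionRing (CoordRing K r)} (hp : p ∈ Fr (grading K r) (satIdeal Y) 0 x) :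
        toFrac a /
          toFrac q * p ∈
        Fr (grading K r) (combIdeal (satIdeal Y) α β) 0 x := by
      obtain ⟨i, j, f, g, hf, hfI, hg, hij, hgx, rfl⟩ := hp
      exact ⟨m + i, m + j, a * f, q * g, SetLike.mul_mem_graded ha hf, haI f hfI,
        SetLike.mul_mem_graded hq hg, by push_cast; omega, mul_notMem hqx hgx,
        by rw [map_mul, map_mul, div_mul_div_comm]⟩
    rw [map_add, map_mul, map_mul, hα', hβ']
    exact add_mem_Fr
      (key hα (fun u hu => mem_combIdeal.2 ⟨u, hu, 0, zero_mem _, by ring⟩) hu)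
      (key hβ (fun u hu => mem_combIdeal.2 ⟨0, zero_mem _, u, hu, by ring⟩) hv)

/-- The Koszul relations between two coprime forms generate their syzygies also locally. -/
theorem exists_koszul_stalk {m : ℕ} {α β : CoordRing K r}
    (hα : α ∈ grading K r m) (hβ : β ∈ grading K r m) (hαβ : IsRelPrime α β)
    {x : ProjSpace K r} {q : CoordRing K r}
    (hq : q ∈ grading K r m) (hqx : q ∉ x.asHomogeneousIdeal)
    {α' β' : (ProjSpace K r).presheaf.stalk x}
    (hα' : stalkToF x α' = toFrac α /
      toFrac q)
    (hβ' : stalkToF x β' = toFrac β /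
      toFrac q)
    (u v : (ProjSpace K r).presheaf.stalk x) (h : α' * u + β' * v = 0) :
    ∃ w, u = β' * w ∧ v = -(α' * w) := by
  have hq0 := algebraMap_ne_zero (ne_zero_of_notMem hqx)
  obtain ⟨i, j, f, g, hf, -, hg, hij, hgx, hu⟩ := stalkToF_mem_Fr x u
  obtain ⟨i', j', f', g', hf', -, hg', hij', hgx', hv⟩ := stalkToF_mem_Fr x v
  obtain rfl : i = j := by omega
  obtain rfl : i' = j' := by omega
  have hg0 := algebraMap_ne_zero (ne_zero_of_notMem hgx)
  have hg0' := algebraMap_ne_zero (ne_zero_of_notMem hgx')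
  have h1 : α * (f * g') + β * (f' * g) = 0 := by
    apply IsFractionRing.injective (CoordRing K r) (FractionRing (CoordRing K r))
    have h2 := congrArg (stalkToF x) h
    rw [map_add, map_mul, map_mul, hu, hv, hα', hβ', map_zero] at h2
    field_simp at h2
    simp only [map_add, map_mul, map_zero]
    linear_combination h2
  obtain ⟨w, hw₁, hw₂⟩ := exists_koszul hαβ h1
  have hw : q * w ∈ grading K r (i + i') := by
    have h2 : w = 0 ∨ ∃ k : ℕ, ((i + i' : ℕ) : ℤ) - m = k ∧ w ∈ grading K r k := by
      obtain h0 | h0 := ne_zero_or_ne_zero_of_isRelPrime hαβ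
      · refine mem_grading_of_mul hα h0 (i := i + i') ?_ (by ring)
        have : α * w = -(f' * g) := by rw [hw₂, neg_neg]
        rw [this, add_comm i i']
        exact neg_mem (SetLike.mul_mem_graded hf' hg)
      · refine mem_grading_of_mul hβ h0 (i := i + i') ?_ (by ring)
        rw [← hw₁]
        exact SetLike.mul_mem_graded hf hg'
    obtain rfl | ⟨k, hk, hwk⟩ := h2
    · rw [mul_zero]; exact zero_mem _
    · obtain h3 : i + i' = m + k := by omega
      rw [h3]
      exact SetLike.mul_mem_graded hq hwk
  obtain ⟨w', hw'⟩ := exists_stalkToF_eq (𝒜 := grading K r) (x := x)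
    ⟨i + i', i + i', q * w, g * g', hw, trivial, SetLike.mul_mem_graded hg hg', (add_zero _).symm,
      mul_notMem hgx hgx', rfl⟩
  have e₁ := congrArg (toFrac) hw₁
  have e₂ := congrArg (toFrac) hw₂
  simp only [map_mul, map_neg] at e₁ e₂
  refine ⟨w', stalkToF_injective x ?_, stalkToF_injective x ?_⟩
  · rw [map_mul, hu, hw', hβ', map_mul, map_mul]
    field_simp
    linear_combination e₁
  · rw [map_neg, map_mul, hv, hw', hα', map_mul, map_mul]
    field_simp
    linear_combination e₂

theorem not_isLCIAt {m : ℕ} {α β : CoordRing K r}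
    (hα : α ∈ grading K r m) (hβ : β ∈ grading K r m) (hαI : α ∈ satIdeal Y) (hβI : β ∈ satIdeal Y)
    (hαβ : IsRelPrime α β)
    (h : satIdeal D = combIdeal (satIdeal Y) α β) {x : ProjSpace K r} (hx : x ∈ Y.support) :
    ¬ IsLCIAt D x := by
  rintro ⟨rs, hrs, he⟩
  obtain ⟨l, hl⟩ := exists_X_notMem x
  have hq := X_pow_mem_grading (K := K) l m
  have hqx : (MvPolynomial.X l : CoordRing K r) ^ m ∉ x.asHomogeneousIdeal :=
    fun h => hl ((ProjectiveSpectrum.isPrime x).mem_of_pow_mem _ h)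
  obtain ⟨α', hα'⟩ := exists_stalkToF_eq (𝒜 := grading K r) (x := x)
    ⟨m, m, α, _, hα, trivial, hq, (add_zero _).symm, hqx, rfl⟩
  obtain ⟨β', hβ'⟩ := exists_stalkToF_eq (𝒜 := grading K r) (x := x)
    ⟨m, m, β, _, hβ, trivial, hq, (add_zero _).symm, hqx, rfl⟩
  have hαI' : α' ∈ stalkIdeal Y x :=
    (mem_stalkIdeal_iff Y x _).2 ⟨m, m, α, _, hα, hαI, hq, (add_zero _).symm, hqx, hα'⟩
  have hβI' : β' ∈ stalkIdeal Y x :=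
    (mem_stalkIdeal_iff Y x _).2 ⟨m, m, β, _, hβ, hβI, hq, (add_zero _).symm, hqx, hβ'⟩
  rw [stalkIdeal_eq_combIdeal hα hβ h hq hqx hα' hβ'] at he
  exact ofList_ne_combIdeal (stalkIdeal_ne_top hx) hαI' hβI'
    (exists_koszul_stalk hα hβ hαβ hq hqx hα' hβ') hrs he

end Stalks

end

end ACMConstruction

theorem mainTheorem12 {K : Type u} [Field K] [IsAlgClosed K] (r : ℕ) (hr : 2 ≤ r)
    (Y : (ACMConstruction.ProjSpace K r).IdealSheafData)
    (hY : ACMConstruction.IsACM Y) (hYcodim : ACMConstruction.codim Y = 2)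
    (D : (ACMConstruction.ProjSpace K r).IdealSheafData)
    (hD : ACMConstruction.IsACM D) (hDcodim : ACMConstruction.codim D = 2)
    (hobt : ACMConstruction.IsObtainedFrom
      (ACMConstruction.idealSheaf Y 0 ⊞ ACMConstruction.idealSheaf Y 0) D) :
    ACMConstruction.satIdeal D ≤ ACMConstruction.satIdeal Y ^ 2 ∧
      D ≤ ACMConstruction.firstInfinitesimalNeighbourhood Y ∧
      (∀ y ∈ Y.support, ¬ ACMConstruction.IsLCIAt D y) ∧
      ¬ ACMConstruction.IsGenericallyLCI D := by
  obtain ⟨n, a, k, γ, π, w, hS⟩ := hobt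
  obtain ⟨m, α, β, hα, hβ, hαI, hβI, hαβ, h⟩ := ACMConstruction.exists_eq_combIdeal hr
    (ACMConstruction.isHomogeneous_satIdeal Y)
    (fun f => ACMConstruction.mem_satIdeal_of_X_pow_mul Y)
    (fun x p hp hx => ACMConstruction.not_satIdeal_le_of_prime hYcodim hp hx)
    (ACMConstruction.isHomogeneous_satIdeal D)
    (fun f => ACMConstruction.mem_satIdeal_of_X_pow_mul D)
    (fun x p hp hx => ACMConstruction.not_satIdeal_le_of_prime hDcodim hp hx) γ π w hS
  have hle : ACMConstruction.satIdeal D ≤ ACMConstruction.satIdeal Y ^ 2 := by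
    intro f hf
    rw [h] at hf
    obtain ⟨u, hu, v, hv, rfl⟩ := ACMConstruction.mem_combIdeal.1 hf
    rw [pow_two]
    exact add_mem (Ideal.mul_mem_mul hαI hu) (Ideal.mul_mem_mul hβI hv)
  have hLCI : ∀ y ∈ Y.support, ¬ ACMConstruction.IsLCIAt D y := fun y hy =>
    ACMConstruction.not_isLCIAt hα hβ hαI hβI hαβ h hy
  refine ⟨hle, ACMConstruction.le_pow_of_satIdeal_le_pow hle, hLCI, fun hgen => ?_⟩
  -- A component of `Y` of codimension two is also a component of `D`.
  obtain ⟨y, hy, hy2⟩ := ACMConstruction.exists_coheight_eq_two hYcodim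
  refine hLCI y hy (hgen y ?_ fun z hz hzy =>
    ACMConstruction.eq_of_specializes hDcodim hy2 hz hzy)
  exact (ACMConstruction.mem_support_iff_satIdeal_le D y).2
    ((hle.trans (Ideal.pow_le_self two_ne_zero)).trans
      ((ACMConstruction.mem_support_iff_satIdeal_le Y y).1 hy))
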